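/- A planar map is a finite connected graph with at least one edge (loops and multiple edges allowed), embedded in the 2-sphere without crossings and considered up to orientation-preserving deformation; a quadrangulation is a planar map all of whose faces have degree four. A rooted pointed planar map is a planar map with a marked vertex (the origin) and a marked corner (the root corner, whose vertex is the root vertex); a rooted pointed quadrangulation is a quadrangulation with a marked vertex (the origin) and a marked unoriented edge (the root edge). Let $\mathcal{M}$ and $\mathcal{Q}$ be the sets of rooted pointed planar maps and of rooted pointed quadrangulations of the sphere. Label the vertices of $Q\in\mathcal{Q}$ by their graph distance to the origin. The labels at the ends of each edge of $Q$ differ by one, so the labels around a face, in clockwise order, are $(t-1,t,t+1,t)$ (a simple face) or $(t,t+1,t,t+1)$ (a confluent face). Inside each face of $Q$ draw one new edge. In a simple face it runs along the side from the corner labeled $t-1$ to the next corner in clockwise order around the face; in a confluent face it is the diagonal joining the two corners labeled $t$. Let $\Phi(Q)$ be the embedded graph formed by the new edges and their end points, with the origin of $Q$ as its distinguished vertex, rooted at the corner containing the end point with smallest label of the root edge of $Q$ (a new edge along a side is drawn slightly inside its face, so this corner is unambiguous). Theorem. For every rooted pointed quadrangulation $Q$, $\Phi(Q)$ is a rooted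 pointed planar map, and $\Phi:\mathcal{Q}\to\mathcal{M}$ is a bijection. It satisfies the following properties: (i) the number of edges of $\Phi(Q)$ equals the number of faces of $Q$; (ii) the number of faces of $\Phi(Q)$ equals the number of local maxima of the distance labeling of $Q$, i.e. of vertices of $Q$ none of whose neighbours is farther from the origin; (iii) the distance in $\Phi(Q)$ from the origin to the root vertex equals the distance in $Q$ from the origin to the closest end point of the root edge. -/

import Mathlib

/-- A finite graph (loops and multiple edges allowed) with a rotation at each vertex, without
isolated vertices. Its darts are the half-edges, seen as pointing away from their vertex; `rot`
sends a dart to the next dart in counterclockwise order around its vertex, and `opp` sends a dart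
to the other half of the same edge. -/
structure RotationSystem where
  Dart : Type
  finite_dart : Finite Dart
  rot : Equiv.Perm Dart
  opp : Equiv.Perm Dart
  opp_opp : ∀ d, opp (opp d) = d
  opp_ne : ∀ d, opp d ≠ d

namespace RotationSystem

variable (M : RotationSystem)

/-- Traverse the edge of a dart, starting at that dart, then take the next edge of the face which
lies on the right-hand side. Hence the darts of a cycle are the sides of a face, listed in clockwise
order around that face. The dart `d` also stands for the corner of this face at the vertex of `d`,
namely the sector between `d` and the next dart clockwise from `d`. -/
def next : Equiv.Perm M.Dart := M.opp.trans M.rot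

def Vertex : Type := Quotient (Equiv.Perm.SameCycle.setoid M.rot)

def Edge : Type := Quotient (Equiv.Perm.SameCycle.setoid M.opp)

def Face : Type := Quotient (Equiv.Perm.SameCycle.setoid M.next)

/-- The vertex at which a dart starts. -/
def vert (d : M.Dart) : M.Vertex := Quotient.mk _ d

/-- The (unoriented) edge of a dart. -/
def edge (d : M.Dart) : M.Edge := Quotient.mk _ d

/-- The face on the right-hand side of a dart. -/
def face (d : M.Dart) : M.Face := Quotient.mk _ d

/-- The degree of a face: the number of its sides. -/
noncomputable def faceDegree (f : M.Face) : ℕ := Nat.card {d : M.Dart // M.face d = f}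

/-- The underlying graph, with loops and multiplicities forgotten. -/
def graph : SimpleGraph M.Vertex :=
  SimpleGraph.fromRel fun u v => ∃ d : M.Dart, M.vert d = u ∧ M.vert (M.opp d) = v

/-- The distance labeling: graph distance from `o` to the vertex of a dart. -/
noncomputable def label (o : M.Vertex) (d : M.Dart) : ℕ := M.graph.dist o (M.vert d)

/-- `v` is a local maximum of the distance to `o`: no neighbour of `v` has a larger label. -/
def IsLocalMax (o v : M.Vertex) : Prop :=
  ∀ d : M.Dart, M.vert d = v → M.label o (M.opp d) ≤ M.label o d

end RotationSystem

/-- A planar map with at least one edge: a connected rotation system for which Euler's formula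
`V - E + F = 2` of the sphere holds. -/
structure PlanarMap extends RotationSystem where
  connected : toRotationSystem.graph.Connected
  euler : Nat.card toRotationSystem.Vertex + Nat.card toRotationSystem.Face
    = Nat.card toRotationSystem.Edge + 2

/-- A rooted pointed quadrangulation of the sphere: all faces have degree four, a vertex
(the origin) and an unoriented edge (the root edge) are marked. -/
structure RootedPointedQuadrangulation extends PlanarMap where
  degree_four : ∀ f, toRotationSystem.faceDegree f = 4
  origin : toRotationSystem.Vertex
  root : toRotationSystem.Edge

/-- A rooted pointed planar map: a vertex (the origin) and a corner (the root corner) are marked.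
The root corner is given by the dart `root`: it is the sector between `root` and the next dart
counterclockwise from it around its vertex. -/
structure RootedPointedMap extends PlanarMap where
  origin : toRotationSystem.Vertex
  root : Dart

/-- An orientation-preserving isomorphism, as a bijection of darts. -/
def IsMapIso (M N : RotationSystem) (f : M.Dart ≃ N.Dart) : Prop :=
  (∀ d, f (M.rot d) = N.rot (f d)) ∧ (∀ d, f (M.opp d) = N.opp (f d))

theorem IsMapIso.refl (M : RotationSystem) : IsMapIso M M (Equiv.refl _) :=
  ⟨fun _ => rfl, fun _ => rfl⟩

theorem IsMapIso.symm {M N : RotationSystem} {f : M.Dart ≃ N.Dart} (h : IsMapIso M N f) :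
    IsMapIso N M f.symm :=
  ⟨fun d => by rw [Equiv.symm_apply_eq, h.1, Equiv.apply_symm_apply],
   fun d => by rw [Equiv.symm_apply_eq, h.2, Equiv.apply_symm_apply]⟩

theorem IsMapIso.trans {M N P : RotationSystem} {f : M.Dart ≃ N.Dart} {g : N.Dart ≃ P.Dart}
    (h : IsMapIso M N f) (k : IsMapIso N P g) : IsMapIso M P (f.trans g) :=
  ⟨fun d => by simp [h.1, k.1], fun d => by simp [h.2, k.2]⟩

namespace RootedPointedQuadrangulation

/-- Isomorphism of rooted pointed quadrangulations: origin and root edge are respected. -/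
def Iso (Q R : RootedPointedQuadrangulation) : Prop :=
  ∃ f : Q.Dart ≃ R.Dart, IsMapIso Q.toRotationSystem R.toRotationSystem f ∧
    (∀ d, Q.vert d = Q.origin ↔ R.vert (f d) = R.origin) ∧
    (∀ d, Q.edge d = Q.root ↔ R.edge (f d) = R.root)

instance isoSetoid : Setoid RootedPointedQuadrangulation where
  r := Iso
  iseqv :=
    { refl := fun Q => ⟨Equiv.refl _, IsMapIso.refl _, fun _ => Iff.rfl, fun _ => Iff.rfl⟩
      symm := by
        rintro Q R ⟨f, hf, ho, hr⟩
        exact ⟨f.symm, hf.symm, fun d => by simpa using (ho (f.symm d)).symm,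
          fun d => by simpa using (hr (f.symm d)).symm⟩
      trans := by
        rintro Q R S ⟨f, hf, ho, hr⟩ ⟨g, hg, ho', hr'⟩
        exact ⟨f.trans g, hf.trans hg, fun d => (ho d).trans (ho' _),
          fun d => (hr d).trans (hr' _)⟩ }

/-- The set of rooted pointed quadrangulations of the sphere, up to deformation. -/
def Class : Type 1 := Quotient isoSetoid

def toClass (Q : RootedPointedQuadrangulation) : Class := Quotient.mk _ Q

end RootedPointedQuadrangulation

namespace RootedPointedMap

/-- Isomorphism of rooted pointed planar maps: origin and root corner are respected. -/
def Iso (M N : RootedPointedMap) : Prop :=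
  ∃ f : M.Dart ≃ N.Dart, IsMapIso M.toRotationSystem N.toRotationSystem f ∧
    (∀ d, M.vert d = M.origin ↔ N.vert (f d) = N.origin) ∧ f M.root = N.root

instance isoSetoid : Setoid RootedPointedMap where
  r := Iso
  iseqv :=
    { refl := fun M => ⟨Equiv.refl _, IsMapIso.refl _, fun _ => Iff.rfl, rfl⟩
      symm := by
        rintro M N ⟨f, hf, ho, hr⟩
        exact ⟨f.symm, hf.symm, fun d => by simpa using (ho (f.symm d)).symm,
          by rw [← hr, Equiv.symm_apply_apply]⟩
      trans := by
        rintro M N P ⟨f, hf, ho, hr⟩ ⟨g, hg, ho', hr'⟩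
        exact ⟨f.trans g, hf.trans hg, fun d => (ho d).trans (ho' _), by simp [hr, hr']⟩ }

/-- The set of rooted pointed planar maps, up to deformation. -/
def Class : Type 1 := Quotient isoSetoid

def toClass (M : RootedPointedMap) : Class := Quotient.mk _ M

end RootedPointedMap

namespace RootedPointedQuadrangulation

variable (Q : RootedPointedQuadrangulation)

/-- The label of the vertex of a dart: its distance to the origin. -/
noncomputable def lab (d : Q.Dart) : ℕ := Q.label Q.origin d

/-- The reversed prescription. A coloured edge is drawn inside each face, between two of its
corners. In a simple face, with labels `t - 1, t, t + 1, t` in clockwise order, it follows the side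
from the corner labeled `t - 1` to the next corner in clockwise order. In a confluent face, with
labels `t, t + 1, t, t + 1`, it is the diagonal between the corners labeled `t`. -/
inductive Draws : Q.Dart → Q.Dart → Prop
  | simple (c : Q.Dart) (h₁ : Q.lab (Q.next c) = Q.lab c + 1)
      (h₂ : Q.lab (Q.next (Q.next c)) = Q.lab c + 2)
      (h₃ : Q.lab (Q.next (Q.next (Q.next c))) = Q.lab c + 1) : Draws c (Q.next c)
  | confluent (c : Q.Dart) (h₁ : Q.lab (Q.next c) = Q.lab c + 1)
      (h₂ : Q.lab (Q.next (Q.next c)) = Q.lab c)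
      (h₃ : Q.lab (Q.next (Q.next (Q.next c))) = Q.lab c + 1) : Draws c (Q.next (Q.next c))

/-- A coloured edge is drawn between these two corners. -/
def Joined (c c' : Q.Dart) : Prop := Q.Draws c c' ∨ Q.Draws c' c

/-- The corners at which a coloured edge ends. -/
def colouredCorners : Set Q.Dart := {c | ∃ c', Q.Joined c c'}

/-- `c'` is the first corner with a coloured edge strictly after `c`, going counterclockwise around
the vertex (`c' = c` if `c` is the only such corner of the vertex). -/
def IsNextColoured (c c' : Q.Dart) : Prop :=
  c' ∈ Q.colouredCorners ∧ ∃ k : ℕ, 0 < k ∧ (Q.rot ^ k) c = c' ∧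
    ∀ i : ℕ, 0 < i → i < k → (Q.rot ^ i) c ∉ Q.colouredCorners

/-- The darts of `Q` which one meets, going counterclockwise around the vertex, after the coloured
edge in the corner `c` and before the next coloured edge. The first one is `c`, because the
corner `c` lies between the dart `c` and its clockwise successor. -/
def sector (c : Q.Dart) : Set Q.Dart :=
  {d | ∃ j : ℕ, (Q.rot ^ j) c = d ∧
    ∀ i : ℕ, 0 < i → i ≤ j → (Q.rot ^ i) c ∉ Q.colouredCorners}

/-- `M` is the embedded graph formed by the coloured edges of `Q`, where the half-edge `x` of `M`
is drawn in the corner `ι x` of `Q`. Its origin is the origin of `Q`, and its root corner is the one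
which contains the end point with smallest label of the root edge of `Q`. -/
structure IsColouring (M : RootedPointedMap) (ι : M.Dart → Q.Dart) : Prop where
  injective : Function.Injective ι
  range_eq : Set.range ι = Q.colouredCorners
  edges : ∀ x, Q.Joined (ι x) (ι (M.opp x))
  rotation : ∀ x, Q.IsNextColoured (ι x) (ι (M.rot x))
  origin : ∀ x, M.vert x = M.origin ↔ Q.vert (ι x) = Q.origin
  root : ∃ d, Q.edge d = Q.root ∧ Q.lab d < Q.lab (Q.opp d) ∧ d ∈ Q.sector (ι M.root)

/-- `M` is the result of the reversed prescription applied to `Q`. -/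
def Yields (M : RootedPointedMap) : Prop := ∃ ι : M.Dart → Q.Dart, Q.IsColouring M ι

end RootedPointedQuadrangulation

/-! In a planar quadrangulation the distance labels change by exactly one along every edge, because
even face degrees force bipartiteness (`exists_two_colouring`, an exactness statement modulo 2).
Each face therefore has exactly two ascending sides, and in both face types the prescription joins
precisely the corners of these two sides (`joined_iff`). So the darts of the image `M` are the
ascending darts of `Q`, one for each edge of `Q`; the rotation of `M` is the first return of the
rotation of `Q`. `IsAscentMap` records this description.

Vertices of `M` are the vertices of `Q` that are not local maxima, and edges of `M` are the faces of
`Q`. For the faces of `M`, attach each dart `x` to the first ascending dart met clockwise around the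
end point of `ι x`. Labels grow under attachment, so iteration stops at a local maximum. This
maximum is constant along a left face of `M`, and darts with the same maximum lie on one left face
(`card_face`). These counts make the Euler relations of `Q` and `M` equivalent (`euler_iff`). The
restricted labels satisfy a local characterisation of distance (`IsDistanceLabel`), which yields
both connectedness of `M` and the statement on distances.

For the inverse, the key is `Attached.reaches`: the dart to which `x` is attached is the first dart
of larger label along the left face of `x`. Attachment is thus determined by `M` and its distances
alone. Conversely, each edge of `M` prescribes the four sides of a face, and `slot` prescribes the
gluing of descending sides to ascending ones. The resulting `quadSystem` gives back `M`
(`QuadSystem.isAscentMap`), and every quadrangulation yielding `M` is isomorphic to it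
(`fromQuadSystem_bijective`, `fromQuadSystem_rot`). -/

/-! ### Invariants and orbit counts of permutations. -/

theorem Equiv.Perm.SameCycle.apply_eq_of_invariant {α β : Type*} {σ : Equiv.Perm α} {h : α → β}
    (hσ : ∀ a, h (σ a) = h a) {a b : α} (hab : σ.SameCycle a b) : h a = h b := by
  obtain ⟨n, rfl⟩ := hab
  have key : ∀ n : ℕ, ∀ a, h ((σ ^ n) a) = h a := by
    intro n
    induction n with
    | zero => intro a; rfl
    | succ n ih => intro a; rw [pow_succ', Equiv.Perm.mul_apply, hσ, ih]
  cases n with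
  | ofNat n => exact (key n a).symm
  | negSucc n =>
    have := key (n + 1) ((σ ^ Int.negSucc n) a)
    rw [← Equiv.Perm.mul_apply, zpow_negSucc, mul_inv_cancel] at this
    rw [zpow_negSucc, ← this]
    rfl

theorem Nat.card_quotient_sameCycle {α β : Type*} {σ : Equiv.Perm α} {F : α → β}
    (hF : Function.Surjective F) (h : ∀ a b, F a = F b ↔ σ.SameCycle a b) :
    Nat.card (Quotient (Equiv.Perm.SameCycle.setoid σ)) = Nat.card β := by
  refine Nat.card_congr (Equiv.ofBijective
    (Quotient.lift (s := Equiv.Perm.SameCycle.setoid σ) F fun a b hab => (h a b).2 hab) ⟨?_, ?_⟩)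
  · rintro ⟨a⟩ ⟨b⟩ hab
    exact Quotient.sound ((h a b).1 hab)
  · intro b
    obtain ⟨a, rfl⟩ := hF b
    exact ⟨Quotient.mk _ a, rfl⟩

/-! ### Rotation systems and the local characterisation of distance. -/

namespace RotationSystem

variable (R : RotationSystem)

instance : Finite R.Dart := R.finite_dart

instance : Finite R.Vertex := inferInstanceAs (Finite (Quotient _))

instance : Finite R.Edge := inferInstanceAs (Finite (Quotient _))

instance : Finite R.Face := inferInstanceAs (Finite (Quotient _))

theorem next_apply (d : R.Dart) : R.next d = R.rot (R.opp d) := rfl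

theorem next_opp (d : R.Dart) : R.next (R.opp d) = R.rot d := by
  rw [next_apply, R.opp_opp]

theorem opp_injective : Function.Injective R.opp := R.opp.injective

theorem vert_eq_iff {a b : R.Dart} : R.vert a = R.vert b ↔ R.rot.SameCycle a b := Quotient.eq

theorem face_eq_iff {a b : R.Dart} : R.face a = R.face b ↔ R.next.SameCycle a b := Quotient.eq

theorem vert_rot (d : R.Dart) : R.vert (R.rot d) = R.vert d := by
  rw [vert_eq_iff, Equiv.Perm.sameCycle_apply_left]

theorem vert_rot_pow (n : ℕ) (d : R.Dart) : R.vert ((R.rot ^ n) d) = R.vert d := by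
  rw [vert_eq_iff, Equiv.Perm.sameCycle_pow_left]

theorem vert_next (d : R.Dart) : R.vert (R.next d) = R.vert (R.opp d) := R.vert_rot _

theorem face_next (d : R.Dart) : R.face (R.next d) = R.face d := by
  rw [face_eq_iff, Equiv.Perm.sameCycle_apply_left]

theorem vert_surjective : Function.Surjective R.vert := Quotient.mk_surjective

theorem edge_surjective : Function.Surjective R.edge := Quotient.mk_surjective

theorem face_surjective : Function.Surjective R.face := Quotient.mk_surjective

theorem sameCycle_opp_iff {a b : R.Dart} : R.opp.SameCycle a b ↔ b = a ∨ b = R.opp a := by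
  constructor
  · intro h
    have : ({a, R.opp a} : Set R.Dart) = {b, R.opp b} :=
      h.apply_eq_of_invariant (h := fun d => ({d, R.opp d} : Set R.Dart)) fun d => by
        rw [R.opp_opp, Set.pair_comm]
    have hb : b ∈ ({a, R.opp a} : Set R.Dart) := by rw [this]; simp
    simpa using hb
  · rintro (rfl | rfl)
    · exact Equiv.Perm.SameCycle.refl _ _
    · exact (Equiv.Perm.sameCycle_apply_right).2 (Equiv.Perm.SameCycle.refl _ _)

theorem edge_eq_iff {a b : R.Dart} : R.edge a = R.edge b ↔ b = a ∨ b = R.opp a :=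
  Quotient.eq.trans R.sameCycle_opp_iff

theorem edge_opp (d : R.Dart) : R.edge (R.opp d) = R.edge d :=
  (R.edge_eq_iff.2 (Or.inr rfl)).symm

theorem card_dart : Nat.card R.Dart = 2 * Nat.card R.Edge := by
  classical
  have := Fintype.ofFinite R.Dart
  have := Fintype.ofFinite R.Edge
  rw [Nat.card_eq_fintype_card, Nat.card_eq_fintype_card, ← Finset.card_univ,
    Finset.card_eq_sum_card_fiberwise (f := R.edge) (t := Finset.univ) (by simp),
    Finset.sum_const_nat (m := 2), Finset.card_univ, mul_comm]
  intro e _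
  obtain ⟨d, rfl⟩ := R.edge_surjective e
  rw [Finset.card_eq_two]
  refine ⟨d, R.opp d, (R.opp_ne d).symm, ?_⟩
  ext b
  simp only [Finset.mem_filter, Finset.mem_univ, true_and, Finset.mem_insert, Finset.mem_singleton]
  rw [eq_comm, R.edge_eq_iff]

theorem eq_of_connected (hR : R.graph.Connected) {β : Type*} {h : R.Dart → β}
    (hrot : ∀ d, h (R.rot d) = h d) (hopp : ∀ d, h (R.opp d) = h d) (a b : R.Dart) :
    h a = h b := by
  have key : ∀ u v : R.Vertex, R.graph.Walk u v → ∀ a b, R.vert a = u → R.vert b = v →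
      h a = h b := by
    intro u v p
    induction p with
    | nil =>
      rintro a b rfl hb
      exact (R.vert_eq_iff.1 hb.symm).apply_eq_of_invariant hrot
    | cons hadj p ih =>
      rintro a b rfl rfl
      rcases hadj with ⟨-, ⟨d, hd, rfl⟩ | ⟨d, rfl, hd⟩⟩
      · rw [← ih _ b rfl rfl, hopp]
        exact (R.vert_eq_iff.1 hd.symm).apply_eq_of_invariant hrot
      · rw [← ih _ b rfl rfl, ← hopp d]
        exact (R.vert_eq_iff.1 hd.symm).apply_eq_of_invariant hrot
  exact key _ _ (hR.preconnected (R.vert a) (R.vert b)).some a b rfl rfl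

theorem dist_opp_le (o : R.Vertex) (hR : R.graph.Connected) (d : R.Dart) :
    R.label o (R.opp d) ≤ R.label o d + 1 := by
  by_cases h : R.vert d = R.vert (R.opp d)
  · rw [label, ← h]; exact Nat.le_succ _
  · refine (hR.dist_triangle (v := R.vert d)).trans (Nat.add_le_add_left ?_ _)
    have hadj : R.graph.Adj (R.vert d) (R.vert (R.opp d)) := ⟨h, Or.inl ⟨d, rfl, rfl⟩⟩
    exact (SimpleGraph.dist_eq_one_iff_adj.2 hadj).le

/-- The properties of a function on darts which characterise the distance to `o`. -/
structure IsDistanceLabel (o : R.Vertex) (l : R.Dart → ℕ) : Prop where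
  rot_eq : ∀ d, l (R.rot d) = l d
  opp_le : ∀ d, l (R.opp d) ≤ l d + 1
  zero_iff : ∀ d, l d = 0 ↔ R.vert d = o
  exists_lt : ∀ d, l d ≠ 0 → ∃ d', R.vert d' = R.vert d ∧ l (R.opp d') < l d

variable {R}

namespace IsDistanceLabel

variable {o : R.Vertex} {l : R.Dart → ℕ}

theorem eq_of_vert_eq (h : R.IsDistanceLabel o l) {a b : R.Dart} (hab : R.vert a = R.vert b) :
    l a = l b :=
  (R.vert_eq_iff.1 hab).apply_eq_of_invariant h.rot_eq

theorem exists_walk (h : R.IsDistanceLabel o l) :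
    ∀ (n : ℕ) (d : R.Dart), l d = n → ∃ p : R.graph.Walk (R.vert d) o, p.length ≤ n := by
  intro n
  induction n using Nat.strong_induction_on with
  | _ n ih =>
    intro d hd
    by_cases h0 : l d = 0
    · rw [(h.zero_iff d).1 h0]
      exact ⟨.nil, by simp⟩
    · obtain ⟨d', hv, hlt⟩ := h.exists_lt d h0
      obtain ⟨p, hp⟩ := ih _ (hd ▸ hlt) _ rfl
      have hne : R.vert d ≠ R.vert (R.opp d') := fun e => by
        rw [h.eq_of_vert_eq e] at hlt
        exact lt_irrefl _ hlt
      have hadj : R.graph.Adj (R.vert d) (R.vert (R.opp d')) := ⟨hne, Or.inl ⟨d', hv, rfl⟩⟩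
      exact ⟨.cons hadj p, by simp only [SimpleGraph.Walk.length_cons]; omega⟩

theorem connected (h : R.IsDistanceLabel o l) : R.graph.Connected := by
  have : ∀ v, R.graph.Reachable v o := fun v => by
    obtain ⟨d, rfl⟩ := R.vert_surjective v
    exact ⟨(h.exists_walk _ d rfl).choose⟩
  exact { preconnected := fun u v => (this u).trans (this v).symm, nonempty := ⟨o⟩ }

theorem le_add_length (h : R.IsDistanceLabel o l) {u v : R.Vertex} (p : R.graph.Walk u v) :
    ∀ a b, R.vert a = u → R.vert b = v → l b ≤ l a + p.length := by
  induction p with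
  | nil =>
    rintro a b rfl hb
    simp [h.eq_of_vert_eq hb]
  | cons hadj p ih =>
    rintro a b rfl rfl
    rw [SimpleGraph.Walk.length_cons]
    rcases hadj with ⟨-, ⟨d, hd, rfl⟩ | ⟨d, rfl, hd⟩⟩
    · have := ih (R.opp d) b rfl rfl
      have := h.opp_le d
      have := h.eq_of_vert_eq hd
      omega
    · have := ih d b rfl rfl
      have := h.opp_le (R.opp d)
      rw [R.opp_opp] at this
      have := h.eq_of_vert_eq hd
      omega

/-- Following smaller labels gives a walk to `o` of length at most `l d`; conversely `l` vanishes at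
`o` and grows by at most one per step of any walk. -/
theorem label_eq (h : R.IsDistanceLabel o l) (d : R.Dart) : R.label o d = l d := by
  apply le_antisymm
  · obtain ⟨p, hp⟩ := h.exists_walk _ d rfl
    rw [label, SimpleGraph.dist_comm]
    exact (SimpleGraph.dist_le p).trans hp
  · obtain ⟨p, hp⟩ := h.connected.exists_walk_length_eq_dist o (R.vert d)
    obtain ⟨a, ha⟩ := R.vert_surjective o
    have := h.le_add_length p a d ha rfl
    rw [(h.zero_iff a).2 ha, hp, zero_add] at this
    exact this

end IsDistanceLabel

theorem isDistanceLabel_label (hR : R.graph.Connected) (o : R.Vertex) :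
    R.IsDistanceLabel o (R.label o) where
  rot_eq d := by rw [label, R.vert_rot, label]
  opp_le d := R.dist_opp_le o hR d
  zero_iff d := by
    rw [label, hR.dist_eq_zero_iff, eq_comm]
  exists_lt d hd := by
    obtain ⟨p, hp⟩ := hR.exists_walk_length_eq_dist (R.vert d) o
    rw [label, SimpleGraph.dist_comm, ← hp] at hd
    cases p with
    | nil => simp at hd
    | @cons _ w _ hadj q =>
      have hq : R.graph.dist o w < R.label o d := by
        rw [label, SimpleGraph.dist_comm (v := R.vert d), ← hp, SimpleGraph.dist_comm,
          SimpleGraph.Walk.length_cons]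
        exact Nat.lt_succ_of_le (SimpleGraph.dist_le q)
      rcases hadj with ⟨-, ⟨d', hd', rfl⟩ | ⟨d', rfl, hd'⟩⟩
      · exact ⟨d', hd', hq⟩
      · exact ⟨R.opp d', hd', by rwa [R.opp_opp]⟩

end RotationSystem

/-! ### Bipartiteness through cohomology modulo 2. -/

namespace RotationSystem

variable (R : RotationSystem)

section Incidence

open Matrix

variable {R}

/-- The incidence matrix, over the field with two elements, of a map defined on darts. -/
noncomputable def incidence {X : Type} (p : R.Dart → X) : Matrix X R.Dart (ZMod 2) :=
  open Classical in Matrix.of fun x d => if p d = x then 1 else 0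

theorem incidence_transpose_mulVec {X : Type} [Fintype X] (p : R.Dart → X) (φ : X → ZMod 2)
    (d : R.Dart) : ((incidence p)ᵀ *ᵥ φ) d = φ (p d) := by
  classical
  rw [Matrix.mulVec, dotProduct]
  simp [incidence]

variable [Fintype R.Dart]

theorem incidence_mulVec {X : Type} [DecidableEq X] (p : R.Dart → X) (α : R.Dart → ZMod 2) (x : X) :
    (incidence p *ᵥ α) x = ∑ d with p d = x, α d := by
  rw [Finset.sum_filter, Matrix.mulVec, dotProduct]
  refine Finset.sum_congr rfl fun d _ => ?_
  simp [incidence]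

theorem incidence_edge_mulVec (α : R.Dart → ZMod 2) (d : R.Dart) :
    (incidence R.edge *ᵥ α) (R.edge d) = α d + α (R.opp d) := by
  classical
  rw [incidence_mulVec, ← Finset.sum_pair (R.opp_ne d).symm]
  refine Finset.sum_congr ?_ fun _ _ => rfl
  ext b
  simp only [Finset.mem_filter, Finset.mem_univ, true_and, Finset.mem_insert, Finset.mem_singleton]
  rw [eq_comm, R.edge_eq_iff]

theorem coboundary_mulVec {X : Type} [Fintype X] (p : R.Dart → X) (φ : X → ZMod 2)
    (d : R.Dart) : ((incidence R.edge * (incidence p)ᵀ) *ᵥ φ) (R.edge d)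
      = φ (p d) + φ (p (R.opp d)) := by
  rw [← Matrix.mulVec_mulVec, incidence_edge_mulVec, incidence_transpose_mulVec,
    incidence_transpose_mulVec]

/-- The hypothesis says that the kernel of the coboundary is the line of constants; rank-nullity
does the rest. It is applied to vertices and, dually, to faces. -/
theorem rank_coboundary {X : Type} [Fintype X] [Nonempty X] (p : R.Dart → X)
    (hp : ∀ φ : X → ZMod 2, (∀ d, φ (p d) = φ (p (R.opp d))) → ∀ x y, φ x = φ y) :
    (incidence R.edge * (incidence p)ᵀ).rank + 1 = Fintype.card X := by
  have hker : LinearMap.ker (incidence R.edge * (incidence p)ᵀ).mulVecLin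
      = Submodule.span (ZMod 2) {fun _ => (1 : ZMod 2)} := by
    ext φ
    rw [LinearMap.mem_ker, Matrix.mulVecLin_apply, Submodule.mem_span_singleton]
    constructor
    · intro h
      obtain ⟨x₀⟩ := ‹Nonempty X›
      refine ⟨φ x₀, funext fun x => ?_⟩
      rw [Pi.smul_apply, smul_eq_mul, mul_one]
      refine hp φ (fun d => ?_) _ _
      have := coboundary_mulVec p φ d
      rw [h, Pi.zero_apply] at this
      exact CharTwo.add_eq_zero.1 this.symm
    · rintro ⟨a, rfl⟩
      ext e
      obtain ⟨d, rfl⟩ := R.edge_surjective e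
      rw [coboundary_mulVec]
      exact CharTwo.add_self_eq_zero _
  have h := LinearMap.finrank_range_add_finrank_ker (incidence R.edge * (incidence p)ᵀ).mulVecLin
  rw [hker, finrank_span_singleton (fun h => one_ne_zero (congrFun h (Classical.arbitrary X))),
    Module.finrank_fintype_fun_eq_card] at h
  exact h

/-- A connected map of genus zero all of whose faces have even degree is bipartite. -/
theorem exists_two_colouring (hconn : R.graph.Connected)
    (heuler : Nat.card R.Vertex + Nat.card R.Face = Nat.card R.Edge + 2)
    (heven : ∀ f, Even (R.faceDegree f)) :
    ∃ φ : R.Vertex → ZMod 2, ∀ d, φ (R.vert d) + φ (R.vert (R.opp d)) = 1 := by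
  classical
  have := Fintype.ofFinite R.Vertex
  have := Fintype.ofFinite R.Edge
  have := Fintype.ofFinite R.Face
  have : Nonempty R.Vertex := hconn.nonempty
  have : Nonempty R.Face := by
    obtain ⟨d, -⟩ := R.vert_surjective (Classical.arbitrary R.Vertex)
    exact ⟨R.face d⟩
  have hA : (incidence R.edge * (incidence R.vert)ᵀ).rank + 1 = Fintype.card R.Vertex := by
    refine rank_coboundary _ fun φ hφ x y => ?_
    obtain ⟨a, rfl⟩ := R.vert_surjective x
    obtain ⟨b, rfl⟩ := R.vert_surjective y
    exact R.eq_of_connected hconn (h := fun d => φ (R.vert d)) (fun d => by rw [R.vert_rot])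
      (fun d => (hφ d).symm) a b
  have hB : (incidence R.edge * (incidence R.face)ᵀ).rank + 1 = Fintype.card R.Face := by
    refine rank_coboundary _ fun φ hφ x y => ?_
    obtain ⟨a, rfl⟩ := R.face_surjective x
    obtain ⟨b, rfl⟩ := R.face_surjective y
    refine R.eq_of_connected hconn (h := fun d => φ (R.face d)) (fun d => ?_)
      (fun d => (hφ d).symm) a b
    rw [← R.next_opp, R.face_next, hφ, R.opp_opp]
  set A := incidence R.edge * (incidence R.vert)ᵀ with hAdef
  set B := incidence R.face * (incidence R.edge)ᵀ with hBdef
  have hBt : incidence R.edge * (incidence R.face)ᵀ = Bᵀ := by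
    rw [hBdef, Matrix.transpose_mul, Matrix.transpose_transpose]
  rw [hBt, Matrix.rank_transpose] at hB
  -- A coboundary sums to zero around a face: `next` matches the end points of the sides with their
  -- starting points.
  have hBA : LinearMap.range A.mulVecLin ≤ LinearMap.ker B.mulVecLin := by
    rintro _ ⟨φ, rfl⟩
    rw [LinearMap.mem_ker, Matrix.mulVecLin_apply, Matrix.mulVecLin_apply]
    ext f
    rw [hBdef, ← Matrix.mulVec_mulVec, incidence_mulVec]
    simp only [incidence_transpose_mulVec, hAdef, coboundary_mulVec]
    rw [Finset.sum_add_distrib, Pi.zero_apply, CharTwo.add_eq_zero]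
    refine (Finset.sum_equiv R.next ?_ ?_).symm
    · intro d; simp [R.face_next]
    · intro d _; rw [R.vert_next]
  have hker := LinearMap.finrank_range_add_finrank_ker B.mulVecLin
  rw [Module.finrank_fintype_fun_eq_card] at hker
  -- Euler's formula makes the dimensions agree: V - 1 = E - (F - 1).
  have hrange : LinearMap.range A.mulVecLin = LinearMap.ker B.mulVecLin := by
    apply Submodule.eq_of_le_of_finrank_eq hBA
    rw [Matrix.rank] at hA hB
    simp only [Nat.card_eq_fintype_card] at heuler
    omega
  -- Even degrees make the all-ones cochain a cocycle; a primitive of it is the two-colouring.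
  have hone : (fun _ => 1 : R.Edge → ZMod 2) ∈ LinearMap.ker B.mulVecLin := by
    rw [LinearMap.mem_ker, Matrix.mulVecLin_apply]
    ext f
    rw [hBdef, ← Matrix.mulVec_mulVec, incidence_mulVec]
    simp only [incidence_transpose_mulVec, Pi.zero_apply]
    rw [Finset.sum_const, nsmul_one, ZMod.natCast_eq_zero_iff_even, ← Fintype.card_subtype,
      ← Nat.card_eq_fintype_card]
    exact heven f
  rw [← hrange] at hone
  obtain ⟨φ, hφ⟩ := hone
  refine ⟨φ, fun d => ?_⟩
  rw [← coboundary_mulVec, ← hAdef, ← Matrix.mulVecLin_apply, hφ]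

end Incidence

/-- The colouring computes the parity of the distance, so equal labels at the two ends of an edge
are impossible. -/
theorem opp_label_of_two_colouring (hconn : R.graph.Connected) {φ : R.Vertex → ZMod 2}
    (hφ : ∀ d, φ (R.vert d) + φ (R.vert (R.opp d)) = 1) (o : R.Vertex) (d : R.Dart) :
    R.label o (R.opp d) = R.label o d + 1 ∨ R.label o d = R.label o (R.opp d) + 1 := by
  have hwalk : ∀ u v : R.Vertex, ∀ p : R.graph.Walk u v, φ v = φ u + p.length := by
    intro u v p
    induction p with
    | nil => simp
    | @cons u w v hadj p ih =>
      have hadj' : φ u + φ w = 1 := by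
        rcases hadj with ⟨-, ⟨d, rfl, rfl⟩ | ⟨d, rfl, rfl⟩⟩
        · exact hφ d
        · rw [add_comm]; exact hφ d
      rw [ih, SimpleGraph.Walk.length_cons, Nat.cast_add, Nat.cast_one, ← hadj']
      have := CharTwo.add_self_eq_zero (φ u)
      linear_combination (-1 : ZMod 2) * this
  have hlabel : ∀ d, φ (R.vert d) = φ o + R.label o d := by
    intro d
    obtain ⟨p, hp⟩ := hconn.exists_walk_length_eq_dist o (R.vert d)
    rw [hwalk _ _ p, hp, label]
  have h₁ := R.dist_opp_le o hconn d
  have h₂ := R.dist_opp_le o hconn (R.opp d)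
  rw [R.opp_opp] at h₂
  have h₃ : R.label o (R.opp d) ≠ R.label o d := by
    intro h
    have := hφ d
    rw [hlabel d, hlabel (R.opp d), h, CharTwo.add_self_eq_zero] at this
    exact zero_ne_one this
  omega

end RotationSystem

/-! ### Ascending darts, attachment, and left faces of the image map. -/

namespace RotationSystem

section Definitions

variable (R : RotationSystem)

/-- Traverse an edge, then take the next edge of the face on the left-hand side. -/
def nextLeft : Equiv.Perm R.Dart := R.opp.trans R.rot.symm

variable {R}

theorem rot_nextLeft (d : R.Dart) : R.rot (R.nextLeft d) = R.opp d := R.rot.apply_symm_apply _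

theorem eq_nextLeft_of_rot_eq {a b : R.Dart} (h : R.rot b = R.opp a) : b = R.nextLeft a :=
  R.rot.injective (h.trans (rot_nextLeft a).symm)

variable (R)

/-- A labeling of the vertices of a quadrangulation which varies by one along each edge. -/
structure IsQuadLabelling (l : R.Dart → ℕ) : Prop where
  rot_eq : ∀ d, l (R.rot d) = l d
  opp_eq : ∀ d, l (R.opp d) = l d + 1 ∨ l d = l (R.opp d) + 1
  next_four : ∀ d, R.next (R.next (R.next (R.next d))) = d
  next_two_ne : ∀ d, R.next (R.next d) ≠ d

/-- The label increases along the dart `d`. -/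
def Ascends (l : R.Dart → ℕ) (d : R.Dart) : Prop := l (R.opp d) = l d + 1

/-- No dart at `v` ascends. -/
def IsPeak (l : R.Dart → ℕ) (v : R.Vertex) : Prop := ∀ d, R.vert d = v → ¬ R.Ascends l d

/-- The other ascending dart in the face of an ascending dart. -/
noncomputable def partner (l : R.Dart → ℕ) (d : R.Dart) : R.Dart :=
  open Classical in
  if R.Ascends l (R.next d) then R.next d
  else if R.Ascends l (R.next (R.next d)) then R.next (R.next d)
  else R.next (R.next (R.next d))

end Definitions

namespace IsQuadLabelling

variable {Q : RotationSystem} {l : Q.Dart → ℕ}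

theorem next_eq (hQ : Q.IsQuadLabelling l) (d : Q.Dart) : l (Q.next d) = l (Q.opp d) :=
  hQ.rot_eq _

theorem ascends_opp (hQ : Q.IsQuadLabelling l) {d : Q.Dart} (hd : ¬ Q.Ascends l d) :
    Q.Ascends l (Q.opp d) := by
  rw [Ascends, Q.opp_opp]
  exact (hQ.opp_eq d).resolve_left hd

theorem not_ascends_opp {d : Q.Dart} (hd : Q.Ascends l d) : ¬ Q.Ascends l (Q.opp d) := by
  rw [Ascends] at *
  rw [Q.opp_opp]
  omega

theorem label_of_not_ascends (hQ : Q.IsQuadLabelling l) {d : Q.Dart} (hd : ¬ Q.Ascends l d) :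
    l d = l (Q.next d) + 1 := by
  rw [hQ.next_eq]
  exact (hQ.opp_eq d).resolve_left hd

theorem label_of_ascends (hQ : Q.IsQuadLabelling l) {d : Q.Dart} (hd : Q.Ascends l d) :
    l (Q.next d) = l d + 1 := by
  rw [hQ.next_eq]
  exact hd

theorem rot_pow_eq (hQ : Q.IsQuadLabelling l) (n : ℕ) (d : Q.Dart) : l ((Q.rot ^ n) d) = l d :=
  (Equiv.Perm.SameCycle.apply_eq_of_invariant hQ.rot_eq
    (Equiv.Perm.sameCycle_pow_right.2 (Equiv.Perm.SameCycle.refl _ _))).symm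

end IsQuadLabelling

/-- `M` is formed by joining the two ascending darts of each face of `Q`, the dart `x` of `M` being
drawn in the corner of the ascending dart `ι x`. -/
structure IsAscentMap (Q M : RotationSystem) (l : Q.Dart → ℕ) (ι : M.Dart → Q.Dart) : Prop where
  injective : Function.Injective ι
  range : ∀ c, (∃ x, ι x = c) ↔ Q.Ascends l c
  opp : ∀ x, ι (M.opp x) = Q.partner l (ι x)
  rot : ∀ x, ∃ k, 0 < k ∧ (Q.rot ^ k) (ι x) = ι (M.rot x) ∧
    ∀ i, 0 < i → i < k → ¬ Q.Ascends l ((Q.rot ^ i) (ι x))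

namespace IsAscentMap

variable {Q M : RotationSystem} {l : Q.Dart → ℕ} {ι : M.Dart → Q.Dart}

theorem ascends (h : IsAscentMap Q M l ι) (x : M.Dart) : Q.Ascends l (ι x) :=
  (h.range _).1 ⟨x, rfl⟩

theorem not_ascends (h : IsAscentMap Q M l ι) (x : M.Dart) : ¬ Q.Ascends l (Q.opp (ι x)) :=
  IsQuadLabelling.not_ascends_opp (h.ascends x)

theorem exists_of_not_ascends (hQ : Q.IsQuadLabelling l) (h : IsAscentMap Q M l ι) {d : Q.Dart}
    (hd : ¬ Q.Ascends l d) : ∃ x, Q.opp (ι x) = d := by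
  obtain ⟨x, hx⟩ := (h.range _).2 (hQ.ascends_opp hd)
  exact ⟨x, by rw [hx, Q.opp_opp]⟩

theorem rot_of_ascends (h : IsAscentMap Q M l ι) {x : M.Dart} (hx : Q.Ascends l (Q.rot (ι x))) :
    ι (M.rot x) = Q.rot (ι x) := by
  obtain ⟨k, hk, hk', hi⟩ := h.rot x
  obtain rfl | hlt := (Nat.succ_le_of_lt hk).eq_or_lt
  · rw [← hk', pow_one]
  · exact absurd (by rwa [pow_one]) (hi 1 one_pos hlt)

theorem eq_nextLeft (h : IsAscentMap Q M l ι) {x z : M.Dart} (hz : Q.rot (ι z) = ι (M.opp x)) :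
    z = M.nextLeft x :=
  eq_nextLeft_of_rot_eq (h.injective (by
    rw [← hz]
    exact h.rot_of_ascends (hz ▸ h.ascends _)))

/-- The partner of `ι x` is one, two or three sides further along its face. The dart just clockwise
from `ι (M.opp x)` is the reverse of the preceding side; when that side descends, it is `ι
(M.nextLeft x)`. -/
theorem face_cases (hQ : Q.IsQuadLabelling l) (h : IsAscentMap Q M l ι) (x : M.Dart) :
    (l (ι (M.opp x)) = l (ι x) + 1 ∧ Q.next (ι x) = ι (M.opp x)) ∨
    (l (ι (M.opp x)) = l (ι x) ∧ Q.next (ι x) = Q.opp (ι (M.nextLeft x)) ∧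
      Q.rot (ι (M.nextLeft x)) = ι (M.opp x)) ∨
    (l (ι (M.opp x)) + 1 = l (ι x) ∧ ∃ x', Q.next (ι x) = Q.opp (ι x') ∧
      Q.rot (ι x') = Q.opp (ι (M.nextLeft x)) ∧ Q.rot (ι (M.nextLeft x)) = ι (M.opp x)) := by
  have hx := hQ.label_of_ascends (h.ascends x)
  have hopp := h.opp x
  rw [partner] at hopp
  split_ifs at hopp with h₁ h₂
  · exact Or.inl ⟨hopp ▸ hx, hopp.symm⟩
  · right; left
    obtain ⟨z, hz⟩ := h.exists_of_not_ascends hQ h₁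
    have hl := hQ.label_of_not_ascends h₁
    rw [← hopp] at hl
    rw [← hz, Q.next_opp] at hopp
    obtain rfl := h.eq_nextLeft hopp.symm
    exact ⟨by omega, hz.symm, hopp.symm⟩
  · right; right
    obtain ⟨x', hx'⟩ := h.exists_of_not_ascends hQ h₁
    obtain ⟨z, hz⟩ := h.exists_of_not_ascends hQ h₂
    have hl₁ := hQ.label_of_not_ascends h₁
    have hl₂ := hQ.label_of_not_ascends h₂
    rw [← hopp] at hl₂
    rw [← hz, Q.next_opp] at hopp
    obtain rfl := h.eq_nextLeft hopp.symm
    refine ⟨by omega, x', hx'.symm, ?_, hopp.symm⟩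
    rw [hz, ← hx', Q.next_opp]

/-- Going clockwise around its end point, the dart `ι x` is followed by descending darts until the
dart `ι y`. -/
def Attached (l : Q.Dart → ℕ) (ι : M.Dart → Q.Dart) (x y : M.Dart) : Prop :=
  ∃ j, 0 < j ∧ (Q.rot ^ j) (ι y) = Q.opp (ι x) ∧
    ∀ i, 0 < i → i ≤ j → ¬ Q.Ascends l ((Q.rot ^ i) (ι y))

theorem Attached.label (hQ : Q.IsQuadLabelling l) (h : IsAscentMap Q M l ι) {x y : M.Dart}
    (hxy : Attached l ι x y) : l (ι y) = l (ι x) + 1 := by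
  obtain ⟨j, -, hj, -⟩ := hxy
  rw [← hQ.rot_pow_eq j, hj]
  exact h.ascends x

/-- If the two rotation runs had different lengths, the longer would pass through the start of the
shorter, which ascends. -/
theorem Attached.eq (h : IsAscentMap Q M l ι) {x y z : M.Dart} (hy : Attached l ι x y)
    (hz : Attached l ι x z) : y = z := by
  have key : ∀ {y z : M.Dart} {j j' : ℕ}, j ≤ j' → (Q.rot ^ j) (ι y) = Q.opp (ι x) →
      (Q.rot ^ j') (ι z) = Q.opp (ι x) →
      (∀ i, 0 < i → i ≤ j' → ¬ Q.Ascends l ((Q.rot ^ i) (ι z))) → y = z := by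
    intro y z j j' hle hj hj' hi
    obtain ⟨k, rfl⟩ := Nat.exists_eq_add_of_le hle
    have : ι y = (Q.rot ^ k) (ι z) := by
      apply (Q.rot ^ j).injective
      rw [hj, ← hj', pow_add, Equiv.Perm.mul_apply]
    rcases Nat.eq_zero_or_pos k with rfl | hk
    · exact h.injective this
    · exact absurd (this ▸ h.ascends y) (hi k hk (Nat.le_add_left _ _))
  obtain ⟨j, -, hj, hi⟩ := hy
  obtain ⟨j', -, hj', hi'⟩ := hz
  rcases le_total j j' with hle | hle
  · exact key hle hj hj' hi'
  · exact (key hle hj' hj hi).symm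

theorem Attached.of_rot_eq (h : IsAscentMap Q M l ι) {x y : M.Dart}
    (hxy : Q.rot (ι y) = Q.opp (ι x)) : Attached l ι x y := by
  refine ⟨1, one_pos, hxy, fun i h₀ h₁ => ?_⟩
  obtain rfl : i = 1 := le_antisymm h₁ h₀
  rw [pow_one, hxy]
  exact h.not_ascends x

theorem Attached.rot (h : IsAscentMap Q M l ι) {x x' y : M.Dart} (hxy : Attached l ι x y)
    (hx' : Q.opp (ι x') = Q.rot (Q.opp (ι x))) : Attached l ι x' y := by
  obtain ⟨j, hj₀, hj, hi⟩ := hxy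
  have hj' : (Q.rot ^ (j + 1)) (ι y) = Q.opp (ι x') := by
    rw [pow_succ', Equiv.Perm.mul_apply, hj, hx']
  refine ⟨j + 1, Nat.succ_pos _, hj', fun i h₀ h₁ => ?_⟩
  rcases h₁.eq_or_lt with rfl | h₁
  · rw [hj']
    exact h.not_ascends x'
  · exact hi i h₀ (Nat.le_of_lt_succ h₁)

/-- Here `Q.opp (ι x)` immediately precedes `ι (M.opp x)` in the rotation, hence lies in the gap
between the consecutive ascending darts `ι (M.nextLeft x)` and `ι (M.opp x)`. -/
theorem attached_nextLeft (h : IsAscentMap Q M l ι) {x : M.Dart}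
    (hx : Q.next (ι x) = ι (M.opp x)) : Attached l ι x (M.nextLeft x) := by
  obtain ⟨k, hk, hk', hi⟩ := h.rot (M.nextLeft x)
  rw [rot_nextLeft, ← hx] at hk'
  obtain ⟨k, rfl⟩ := Nat.exists_eq_succ_of_ne_zero hk.ne'
  rw [Nat.succ_eq_add_one, pow_succ', Equiv.Perm.mul_apply, Q.next_apply] at hk'
  have hk'' := Q.rot.injective hk'
  refine ⟨k, Nat.pos_of_ne_zero ?_, hk'', fun i h₀ h₁ => hi i h₀ (Nat.lt_succ_of_le h₁)⟩
  rintro rfl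
  exact h.not_ascends x (hk'' ▸ h.ascends _)

/-- Going along its left face, `y` is reached from `x` through labels at most `m`. -/
def Reaches (M : RotationSystem) (l : M.Dart → ℕ) (m : ℕ) (x y : M.Dart) : Prop :=
  ∃ n : ℕ, (M.nextLeft ^ n) x = y ∧ ∀ i < n, l ((M.nextLeft ^ i) x) ≤ m

theorem Reaches.step {l : M.Dart → ℕ} {m : ℕ} {x y : M.Dart}
    (hx : l x ≤ m) (hxy : Reaches M l m (M.nextLeft x) y) : Reaches M l m x y := by
  obtain ⟨n, rfl, hi⟩ := hxy
  refine ⟨n + 1, by rw [pow_succ, Equiv.Perm.mul_apply], fun i hin => ?_⟩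
  cases i with
  | zero => exact hx
  | succ i =>
    rw [pow_succ, Equiv.Perm.mul_apply]
    exact hi i (Nat.lt_of_succ_lt_succ hin)

theorem Reaches.refl {l : M.Dart → ℕ} (m : ℕ) (x : M.Dart) : Reaches M l m x x :=
  ⟨0, rfl, fun _ hi => absurd hi (Nat.not_lt_zero _)⟩

theorem Reaches.mono {l : M.Dart → ℕ} {m m' : ℕ} (hm : m ≤ m') {x y : M.Dart}
    (hxy : Reaches M l m x y) : Reaches M l m' x y := by
  obtain ⟨n, hn, hi⟩ := hxy
  exact ⟨n, hn, fun i hin => (hi i hin).trans hm⟩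

theorem Reaches.trans {l : M.Dart → ℕ} {m : ℕ} {x y z : M.Dart} (hxy : Reaches M l m x y)
    (hyz : Reaches M l m y z) : Reaches M l m x z := by
  obtain ⟨n, hn, hi⟩ := hxy
  induction n generalizing x with
  | zero => exact (show x = y from hn) ▸ hyz
  | succ n ih =>
    refine Reaches.step (hi 0 n.succ_pos) (ih ?_ fun i hin => ?_)
    · rw [← hn, pow_succ, Equiv.Perm.mul_apply]
    · rw [← Equiv.Perm.mul_apply, ← pow_succ]
      exact hi _ (Nat.succ_lt_succ hin)

theorem Reaches.sameCycle {l : M.Dart → ℕ} {m : ℕ} {x y : M.Dart} (hxy : Reaches M l m x y) :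
    M.nextLeft.SameCycle x y := by
  obtain ⟨n, rfl, -⟩ := hxy
  exact Equiv.Perm.sameCycle_pow_right.2 (Equiv.Perm.SameCycle.refl _ _)

/-- `ih` is `Attached.reaches` for smaller labels, kept as a hypothesis so that this step can serve
inside the induction proving it. It is needed when the label drops: then `M.nextLeft x` is attached
to `x'`. -/
theorem reaches_of_rot_opp_aux (hQ : Q.IsQuadLabelling l) (h : IsAscentMap Q M l ι)
    {x x' : M.Dart}
    (ih : ∀ a b, l (ι a) < l (ι x) → Attached l ι a b → Reaches M (l ∘ ι) (l (ι a)) a b)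
    (hx' : Q.opp (ι x') = Q.rot (Q.opp (ι x))) : Reaches M (l ∘ ι) (l (ι x)) x x' := by
  rw [← Q.next_apply] at hx'
  rcases h.face_cases hQ x with ⟨-, hx⟩ | ⟨-, hx, -⟩ | ⟨hl, z, hx, hz, hw⟩
  · exact absurd (hx' ▸ hx ▸ h.ascends (M.opp x)) (h.not_ascends x')
  · rw [hx] at hx'
    obtain rfl := h.injective (Q.opp_injective hx')
    exact Reaches.step le_rfl (Reaches.refl _ _)
  · rw [hx] at hx'
    obtain rfl := h.injective (Q.opp_injective hx')
    have hlt : l (ι (M.nextLeft x)) < l (ι x) := by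
      rw [← hQ.rot_eq, hw]; omega
    exact Reaches.step le_rfl ((ih _ _ hlt (Attached.of_rot_eq h hz)).mono hlt.le)

/-- If `ι x` is attached to `ι y`, then `y` is the first dart with a label larger than that of `x`
along the left face of `x`. -/
theorem Attached.reaches (hQ : Q.IsQuadLabelling l) (h : IsAscentMap Q M l ι) {x y : M.Dart}
    (hxy : Attached l ι x y) : Reaches M (l ∘ ι) (l (ι x)) x y := by
  induction hm : l (ι x) using Nat.strong_induction_on generalizing x y with
  | _ m ih =>
    obtain ⟨k, hk, hk', hki⟩ := h.rot y
    -- Inner induction on the number `n` of rotation steps left before the next ascending dart. All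
    -- darts ending in this gap are attached to `y`, and each reaches its successor; the last one
    -- has `y` as `M.nextLeft`.
    have key : ∀ n j, j + n = k → ∀ x, l (ι x) = m → 0 < j →
        (Q.rot ^ j) (ι y) = Q.opp (ι x) →
        (∀ i, 0 < i → i ≤ j → ¬ Q.Ascends l ((Q.rot ^ i) (ι y))) →
        Reaches M (l ∘ ι) m x y := by
      intro n
      induction n with
      | zero =>
        rintro j rfl x - hj₀ - hi
        exact absurd (hk' ▸ h.ascends _) (hi _ hj₀ le_rfl)
      | succ n ihn =>
        intro j hjn x hx hj₀ hj hi
        have hj' : (Q.rot ^ (j + 1)) (ι y) = Q.next (ι x) := by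
          rw [pow_succ', Equiv.Perm.mul_apply, hj, Q.next_apply]
        by_cases hup : Q.Ascends l (Q.next (ι x))
        · have hraise : Q.next (ι x) = ι (M.opp x) := by
            rcases h.face_cases hQ x with ⟨-, hx⟩ | ⟨-, hx, -⟩ | ⟨-, z, hx, -, -⟩
            · exact hx
            · exact absurd (hx ▸ hup) (h.not_ascends _)
            · exact absurd (hx ▸ hup) (h.not_ascends _)
          have : y = M.nextLeft x := (Attached.eq h ⟨j, hj₀, hj, hi⟩ (h.attached_nextLeft hraise))
          rw [this]
          exact Reaches.step hx.le (Reaches.refl _ _)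
        · obtain ⟨x', hx'⟩ := h.exists_of_not_ascends hQ hup
          have hatt := Attached.rot h ⟨j, hj₀, hj, hi⟩ (x' := x') (by rw [hx', Q.next_apply])
          have hreach : Reaches M (l ∘ ι) m x x' := by
            rw [← hx]
            refine h.reaches_of_rot_opp_aux hQ (fun a b hlt hab => ?_) (by rw [hx', Q.next_apply])
            exact ih _ (hx ▸ hlt) hab rfl
          refine hreach.trans (ihn (j + 1) (by omega) x' ?_ (Nat.succ_pos _) (hj'.trans hx'.symm) ?_)
          · have h₁ := h.ascends x
            have h₂ := h.ascends x'
            rw [Ascends, hx', hQ.next_eq] at h₂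
            rw [Ascends] at h₁
            omega
          · intro i h₀ h₁
            rcases h₁.eq_or_lt with rfl | h₁
            · rwa [hj']
            · exact hi i h₀ (Nat.le_of_lt_succ h₁)
    obtain ⟨j, hj₀, hj, hi⟩ := hxy
    have hjk : j ≤ k := by
      by_contra hlt
      exact hi k hk (le_of_not_ge hlt) (hk' ▸ h.ascends _)
    exact key (k - j) j (by omega) x hm hj₀ hj hi

theorem reaches_of_rot_opp (hQ : Q.IsQuadLabelling l) (h : IsAscentMap Q M l ι) {x x' : M.Dart}
    (hx' : Q.opp (ι x') = Q.rot (Q.opp (ι x))) : Reaches M (l ∘ ι) (l (ι x)) x x' :=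
  h.reaches_of_rot_opp_aux hQ (fun _ _ _ hab => hab.reaches hQ h) hx'

end IsAscentMap

end RotationSystem

/-! ### Counting vertices, edges and faces; distances in the image map. -/

namespace RotationSystem

namespace IsQuadLabelling

variable {Q : RotationSystem} {l : Q.Dart → ℕ}

theorem ascends_iff (hQ : Q.IsQuadLabelling l) (d : Q.Dart) :
    Q.Ascends l d ↔ l (Q.next d) = l d + 1 := by
  rw [hQ.next_eq, Ascends]

theorem next_cases (hQ : Q.IsQuadLabelling l) (d : Q.Dart) :
    l (Q.next d) = l d + 1 ∨ l d = l (Q.next d) + 1 := by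
  rw [hQ.next_eq]
  exact hQ.opp_eq d

theorem exists_ascends (hQ : Q.IsQuadLabelling l) (d : Q.Dart) :
    ∃ c, Q.Ascends l c ∧ Q.face c = Q.face d := by
  by_contra! hne
  have h₀ := hQ.label_of_not_ascends fun h => hne d h rfl
  have h₁ := hQ.label_of_not_ascends fun h => hne (Q.next d) h (Q.face_next _)
  have h₂ := hQ.label_of_not_ascends fun h => hne (Q.next (Q.next d)) h (by simp only [Q.face_next])
  have h₃ := hQ.label_of_not_ascends fun h =>
    hne (Q.next (Q.next (Q.next d))) h (by simp only [Q.face_next])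
  rw [hQ.next_four] at h₃
  omega

theorem face_partner (d : Q.Dart) : Q.face (Q.partner l d) = Q.face d := by
  rw [partner]
  split_ifs <;> simp only [Q.face_next]

/-- Labels return to their value after four sides, so exactly two ascend. This justifies the
untested last branch of `partner`. -/
theorem ascends_partner (hQ : Q.IsQuadLabelling l) {d : Q.Dart} (hd : Q.Ascends l d) :
    Q.Ascends l (Q.partner l d) := by
  rw [partner]
  split_ifs with h₁ h₂
  · exact h₁
  · exact h₂
  · rw [hQ.ascends_iff] at *
    rw [hQ.next_four]
    have := hQ.next_cases (Q.next d)
    have := hQ.next_cases (Q.next (Q.next d))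
    omega

theorem partner_ne (hQ : Q.IsQuadLabelling l) (d : Q.Dart) : Q.partner l d ≠ d := by
  have hne : ∀ d, Q.next d ≠ d := fun d h => by
    have := hQ.next_cases d
    rw [h] at this
    omega
  rw [partner]
  split_ifs
  · exact hne d
  · exact hQ.next_two_ne d
  · intro h
    have := congrArg Q.next h
    rw [hQ.next_four] at this
    exact hne d this.symm

theorem mem_face_iff (hQ : Q.IsQuadLabelling l) {c d : Q.Dart} (h : Q.face c = Q.face d) :
    c = d ∨ c = Q.next d ∨ c = Q.next (Q.next d) ∨ c = Q.next (Q.next (Q.next d)) := by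
  have : ∀ a b, Q.next.SameCycle a b →
      ({a, Q.next a, Q.next (Q.next a), Q.next (Q.next (Q.next a))} : Set Q.Dart)
        = {b, Q.next b, Q.next (Q.next b), Q.next (Q.next (Q.next b))} := fun a b hab =>
    hab.apply_eq_of_invariant (h := fun a => ({a, Q.next a, Q.next (Q.next a),
      Q.next (Q.next (Q.next a))} : Set Q.Dart)) fun a => by
        rw [hQ.next_four]
        ext b
        simp only [Set.mem_insert_iff, Set.mem_singleton_iff]
        tauto
  have hc : c ∈ ({d, Q.next d, Q.next (Q.next d), Q.next (Q.next (Q.next d))} : Set Q.Dart) := by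
    rw [← this c d (Q.face_eq_iff.1 h)]
    simp
  simpa using hc

theorem eq_or_eq_partner (hQ : Q.IsQuadLabelling l) {c d : Q.Dart} (hc : Q.Ascends l c)
    (hd : Q.Ascends l d) (h : Q.face c = Q.face d) : c = d ∨ c = Q.partner l d := by
  have h₀ := hQ.next_cases d
  have h₁ := hQ.next_cases (Q.next d)
  have h₂ := hQ.next_cases (Q.next (Q.next d))
  have h₃ := hQ.next_cases (Q.next (Q.next (Q.next d)))
  rw [hQ.next_four] at h₃
  rw [partner]
  rcases hQ.mem_face_iff h with rfl | rfl | rfl | rfl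
  · exact Or.inl rfl
  · right; rw [if_pos hc]
  · right
    rw [if_neg, if_pos hc]
    rw [hQ.ascends_iff] at *
    omega
  · right
    rw [hQ.ascends_iff, hQ.next_four] at hc
    rw [if_neg, if_neg] <;>
    · rw [hQ.ascends_iff] at *
      omega

theorem partner_partner (hQ : Q.IsQuadLabelling l) {d : Q.Dart} (hd : Q.Ascends l d) :
    Q.partner l (Q.partner l d) = d :=
  ((hQ.eq_or_eq_partner hd (hQ.ascends_partner hd) (face_partner d).symm).resolve_left
    (hQ.partner_ne d).symm).symm

end IsQuadLabelling

theorem exists_pow_of_vert_eq {R : RotationSystem} {a b : R.Dart} (h : R.vert a = R.vert b) :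
    ∃ n : ℕ, (R.rot ^ n) a = b :=
  let ⟨n, _, hn⟩ := (R.vert_eq_iff.1 h).exists_pow_eq'
  ⟨n, hn⟩

/-- `opp` conjugates the inverse of `next` into `nextLeft`, so faces may be counted as left faces.
-/
theorem sameCycle_nextLeft_opp {M : RotationSystem} {a b : M.Dart} :
    M.nextLeft.SameCycle (M.opp a) (M.opp b) ↔ M.next.SameCycle a b := by
  have ho : M.opp⁻¹ = M.opp := inv_eq_of_mul_eq_one_right (Equiv.ext M.opp_opp)
  have : M.nextLeft = M.opp * M.next⁻¹ * M.opp⁻¹ := by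
    rw [show M.next = M.rot * M.opp from rfl, mul_inv_rev, mul_inv_cancel_left, ho]
    rfl
  rw [this, Equiv.Perm.sameCycle_conj, Equiv.Perm.sameCycle_inv, ho, M.opp_opp, M.opp_opp]

namespace IsAscentMap

variable {Q M : RotationSystem} {l : Q.Dart → ℕ} {ι : M.Dart → Q.Dart}

theorem vert_eq_iff (h : IsAscentMap Q M l ι) {x y : M.Dart} :
    M.vert x = M.vert y ↔ Q.vert (ι x) = Q.vert (ι y) := by
  constructor
  · intro hxy
    refine (M.vert_eq_iff.1 hxy).apply_eq_of_invariant (h := fun x => Q.vert (ι x)) fun x => ?_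
    obtain ⟨k, -, hk, -⟩ := h.rot x
    rw [← hk, Q.vert_rot_pow]
  · intro hxy
    obtain ⟨n, hn⟩ := exists_pow_of_vert_eq hxy
    induction n using Nat.strong_induction_on generalizing x with
    | _ n ih =>
      rcases Nat.eq_zero_or_pos n with rfl | hpos
      · rw [h.injective hn]
      · obtain ⟨k, hk₀, hk, hi⟩ := h.rot x
        -- `ι y` ascends, so it cannot precede the first ascending dart after `ι x`.
        have hkn : k ≤ n := by
          by_contra hlt
          exact hi n hpos (lt_of_not_ge hlt) (hn ▸ h.ascends y)
        rw [← M.vert_rot x]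
        refine ih (n - k) (by omega) ?_ ?_
        · rw [← hk, Q.vert_rot_pow, hxy]
        · rw [← hk, ← Equiv.Perm.mul_apply, ← pow_add, Nat.sub_add_cancel hkn, hn]

theorem card_vertex (h : IsAscentMap Q M l ι) :
    Nat.card M.Vertex = Nat.card {v // ¬ Q.IsPeak l v} := by
  refine Nat.card_quotient_sameCycle
    (F := fun x => ⟨Q.vert (ι x), fun hp => hp _ rfl (h.ascends x)⟩) ?_ fun x y => ?_
  · rintro ⟨v, hv⟩
    rw [IsPeak] at hv
    push Not at hv
    obtain ⟨d, rfl, hd⟩ := hv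
    obtain ⟨x, rfl⟩ := (h.range _).2 hd
    exact ⟨x, rfl⟩
  · rw [Subtype.mk.injEq, ← h.vert_eq_iff, M.vert_eq_iff]

theorem card_edge (hQ : Q.IsQuadLabelling l) (h : IsAscentMap Q M l ι) :
    Nat.card M.Edge = Nat.card Q.Face := by
  refine Nat.card_quotient_sameCycle (F := fun x => Q.face (ι x)) ?_ fun x y => ?_
  · intro f
    obtain ⟨d, rfl⟩ := Q.face_surjective f
    obtain ⟨c, hc, hcd⟩ := hQ.exists_ascends d
    obtain ⟨x, rfl⟩ := (h.range _).2 hc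
    exact ⟨x, hcd⟩
  · rw [sameCycle_opp_iff]
    constructor
    · intro hxy
      refine (hQ.eq_or_eq_partner (h.ascends y) (h.ascends x) hxy.symm).imp ?_ ?_
      · exact fun e => h.injective e
      · exact fun e => h.injective (e.trans (h.opp x).symm)
    · rintro (rfl | rfl)
      · rfl
      · exact ((congrArg Q.face (h.opp x)).trans (IsQuadLabelling.face_partner _)).symm

theorem card_dart (hQ : Q.IsQuadLabelling l) (h : IsAscentMap Q M l ι) :
    Nat.card M.Dart = Nat.card Q.Edge := by
  refine Nat.card_congr (Equiv.ofBijective (fun x => Q.edge (ι x)) ⟨fun x y hxy => ?_, fun e => ?_⟩)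
  · rcases Q.edge_eq_iff.1 hxy with e | e
    · exact (h.injective e).symm
    · exact absurd (e ▸ h.ascends y) (h.not_ascends x)
  · obtain ⟨d, rfl⟩ := Q.edge_surjective e
    by_cases hd : Q.Ascends l d
    · obtain ⟨x, rfl⟩ := (h.range _).2 hd
      exact ⟨x, rfl⟩
    · obtain ⟨x, rfl⟩ := h.exists_of_not_ascends hQ hd
      exact ⟨x, (Q.edge_opp _).symm⟩

/-- `w` is the local maximum obtained from `x` by going repeatedly from a dart to the one to which
it is attached. -/
inductive EndsAt (l : Q.Dart → ℕ) (ι : M.Dart → Q.Dart) : M.Dart → Q.Vertex → Prop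
  | peak {x : M.Dart} : Q.IsPeak l (Q.vert (Q.opp (ι x))) → EndsAt l ι x (Q.vert (Q.opp (ι x)))
  | step {x y : M.Dart} {w : Q.Vertex} : Attached l ι x y → EndsAt l ι y w → EndsAt l ι x w

theorem Attached.not_isPeak (h : IsAscentMap Q M l ι) {x y : M.Dart} (hxy : Attached l ι x y) :
    ¬ Q.IsPeak l (Q.vert (Q.opp (ι x))) := by
  obtain ⟨j, -, hj, -⟩ := hxy
  rw [← hj, Q.vert_rot_pow]
  exact fun hp => hp _ rfl (h.ascends y)

/-- Minimality of the number of rotation steps makes all intermediate darts descending. -/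
theorem exists_attached (h : IsAscentMap Q M l ι) {x : M.Dart}
    (hx : ¬ Q.IsPeak l (Q.vert (Q.opp (ι x)))) : ∃ y, Attached l ι x y := by
  classical
  have hex : ∃ n : ℕ, ∃ y, (Q.rot ^ n) (ι y) = Q.opp (ι x) := by
    rw [IsPeak] at hx
    push Not at hx
    obtain ⟨d, hd, hup⟩ := hx
    obtain ⟨y, rfl⟩ := (h.range _).2 hup
    obtain ⟨n, hn⟩ := exists_pow_of_vert_eq hd
    exact ⟨n, y, hn⟩
  obtain ⟨y, hy⟩ := Nat.find_spec hex
  refine ⟨y, Nat.find hex, Nat.pos_of_ne_zero fun h₀ => ?_, hy, fun i hi₀ hi hup => ?_⟩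
  · rw [h₀] at hy
    exact h.not_ascends x (hy ▸ h.ascends y)
  · obtain ⟨z, hz⟩ := (h.range _).2 hup
    refine Nat.find_min hex (m := Nat.find hex - i) (by omega) ⟨z, ?_⟩
    rw [hz, ← Equiv.Perm.mul_apply, ← pow_add, Nat.sub_add_cancel hi, hy]

theorem exists_endsAt (hQ : Q.IsQuadLabelling l) (h : IsAscentMap Q M l ι) (x : M.Dart) :
    ∃ w, EndsAt l ι x w := by
  obtain ⟨B, hB⟩ := (Set.finite_range l).bddAbove
  have hB' : ∀ d, l d ≤ B := fun d => hB ⟨d, rfl⟩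
  induction hn : B - l (ι x) using Nat.strong_induction_on generalizing x with
  | _ n ih =>
    by_cases hp : Q.IsPeak l (Q.vert (Q.opp (ι x)))
    · exact ⟨_, .peak hp⟩
    · obtain ⟨y, hy⟩ := h.exists_attached hp
      have hl := hy.label hQ h
      have := hB' (ι y)
      obtain ⟨w, hw⟩ := ih (B - l (ι y)) (by omega) y rfl
      exact ⟨w, .step hy hw⟩

theorem EndsAt.eq (h : IsAscentMap Q M l ι) {x : M.Dart} {v w : Q.Vertex} (hv : EndsAt l ι x v)
    (hw : EndsAt l ι x w) : v = w := by
  induction hv with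
  | peak hp =>
    cases hw with
    | peak => rfl
    | step hxy => exact absurd hp (hxy.not_isPeak h)
  | step hxy _ ih =>
    cases hw with
    | peak hp => exact absurd hp (hxy.not_isPeak h)
    | step hxy' hw => exact ih (hxy.eq h hxy' ▸ hw)

theorem EndsAt.rot (h : IsAscentMap Q M l ι) {x x' : M.Dart} {w : Q.Vertex} (hw : EndsAt l ι x w)
    (hx' : Q.opp (ι x') = Q.rot (Q.opp (ι x))) : EndsAt l ι x' w := by
  cases hw with
  | peak hp =>
    have : Q.vert (Q.opp (ι x)) = Q.vert (Q.opp (ι x')) := by rw [hx', Q.vert_rot]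
    rw [this] at hp ⊢
    exact .peak hp
  | step hxy hw => exact .step (hxy.rot h hx') hw

/-- By `face_cases`, `M.nextLeft x` is what `x` is attached to, or has the next descending side at
the same end point, or is attached to such a dart. The final maximum is the same each time. -/
theorem EndsAt.nextLeft (hQ : Q.IsQuadLabelling l) (h : IsAscentMap Q M l ι) {x : M.Dart}
    {w : Q.Vertex} (hw : EndsAt l ι x w) : EndsAt l ι (M.nextLeft x) w := by
  rcases h.face_cases hQ x with ⟨-, hx⟩ | ⟨-, hx, -⟩ | ⟨hl, z, hx, hz, -⟩
  · have hatt := h.attached_nextLeft hx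
    cases hw with
    | peak hp => exact absurd hp (hatt.not_isPeak h)
    | step hxy hw => exact hxy.eq h hatt ▸ hw
  · exact hw.rot h (by rw [← hx, Q.next_apply])
  · exact .step (Attached.of_rot_eq h hz) (hw.rot h (by rw [← hx, Q.next_apply]))

theorem EndsAt.exists_sameCycle (hQ : Q.IsQuadLabelling l) (h : IsAscentMap Q M l ι) {x : M.Dart}
    {w : Q.Vertex} (hw : EndsAt l ι x w) : Q.IsPeak l w ∧
      ∃ y, Q.vert (Q.opp (ι y)) = w ∧ M.nextLeft.SameCycle x y := by
  induction hw with
  | peak hp => exact ⟨hp, _, rfl, Equiv.Perm.SameCycle.refl _ _⟩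
  | step hxy _ ih =>
    obtain ⟨hp, z, hz, hyz⟩ := ih
    exact ⟨hp, z, hz, (hxy.reaches hQ h).sameCycle.trans hyz⟩

/-- Every dart at a local maximum descends, so one can turn around it with `reaches_of_rot_opp`. -/
theorem sameCycle_of_isPeak (hQ : Q.IsQuadLabelling l) (h : IsAscentMap Q M l ι) {x y : M.Dart}
    (hp : Q.IsPeak l (Q.vert (Q.opp (ι x))))
    (hxy : Q.vert (Q.opp (ι x)) = Q.vert (Q.opp (ι y))) : M.nextLeft.SameCycle x y := by
  obtain ⟨n, hn⟩ := exists_pow_of_vert_eq hxy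
  induction n generalizing x with
  | zero => rw [h.injective (Q.opp_injective hn)]
  | succ n ih =>
    obtain ⟨z, hz⟩ := h.exists_of_not_ascends hQ (hp (Q.rot (Q.opp (ι x))) (Q.vert_rot _))
    have hv : Q.vert (Q.opp (ι z)) = Q.vert (Q.opp (ι x)) := by rw [hz, Q.vert_rot]
    refine (h.reaches_of_rot_opp hQ hz).sameCycle.trans (ih (hv ▸ hp) (hv.trans hxy) ?_)
    rw [hz, ← hn, pow_succ, Equiv.Perm.mul_apply]

/-- `EndsAt` is constant on left faces. Conversely each dart shares its left face with one ending
directly at its maximum, and any two of the latter share a left face. -/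
theorem card_face (hQ : Q.IsQuadLabelling l) (h : IsAscentMap Q M l ι) :
    Nat.card M.Face = Nat.card {v // Q.IsPeak l v} := by
  choose e he using h.exists_endsAt hQ
  refine Nat.card_quotient_sameCycle
    (F := fun x => ⟨e (M.opp x), ((he (M.opp x)).exists_sameCycle hQ h).1⟩) ?_ fun x y => ?_
  · rintro ⟨v, hv⟩
    obtain ⟨d, rfl⟩ := Q.vert_surjective v
    obtain ⟨x, rfl⟩ := h.exists_of_not_ascends hQ (hv d rfl)
    refine ⟨M.opp x, Subtype.ext ?_⟩
    have := he (M.opp (M.opp x))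
    rw [M.opp_opp] at this
    simpa [M.opp_opp] using this.eq h (.peak hv)
  · rw [Subtype.mk.injEq, ← sameCycle_nextLeft_opp]
    constructor
    · intro hxy
      obtain ⟨hp, a, ha, hxa⟩ := (he (M.opp x)).exists_sameCycle hQ h
      obtain ⟨-, b, hb, hyb⟩ := (he (M.opp y)).exists_sameCycle hQ h
      exact hxa.trans ((h.sameCycle_of_isPeak hQ (ha ▸ hp) (by rw [ha, hb, hxy])).trans hyb.symm)
    · intro hxy
      refine hxy.apply_eq_of_invariant fun a => ?_
      exact (he _).eq h ((he a).nextLeft hQ h)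

/-- V(M) + F(M) = V(Q), E(M) = F(Q) and 2 E(M) = E(Q). The equivalence serves both directions of the
bijection. -/
theorem euler_iff (hQ : Q.IsQuadLabelling l) (h : IsAscentMap Q M l ι) :
    Nat.card M.Vertex + Nat.card M.Face = Nat.card M.Edge + 2 ↔
      Nat.card Q.Vertex + Nat.card Q.Face = Nat.card Q.Edge + 2 := by
  classical
  have hV : Nat.card Q.Vertex
      = Nat.card {v // Q.IsPeak l v} + Nat.card {v // ¬ Q.IsPeak l v} := by
    rw [← Nat.card_sum]
    exact Nat.card_congr (Equiv.sumCompl _).symm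
  have hE := h.card_dart hQ
  rw [M.card_dart] at hE
  rw [h.card_vertex, h.card_face hQ, hV, ← hE, h.card_edge hQ]
  omega

theorem isDistanceLabel_left (hQ : Q.IsQuadLabelling l) (h : IsAscentMap Q M l ι) {o : Q.Vertex}
    (ho : Q.IsDistanceLabel o l) {o' : M.Vertex} (hoo : ∀ x, M.vert x = o' ↔ Q.vert (ι x) = o) :
    M.IsDistanceLabel o' (l ∘ ι) where
  rot_eq x := by
    obtain ⟨k, -, hk, -⟩ := h.rot x
    rw [Function.comp, Function.comp, ← hk, hQ.rot_pow_eq]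
  opp_le x := by
    rcases h.face_cases hQ x with ⟨hl, -⟩ | ⟨hl, -⟩ | ⟨hl, -⟩ <;>
    · simp only [Function.comp]
      omega
  zero_iff x := (ho.zero_iff _).trans (hoo x).symm
  exists_lt x hx := by
    obtain ⟨d, hd, hlt⟩ := ho.exists_lt _ hx
    have hdn : ¬ Q.Ascends l d := fun hup => by
      rw [Ascends] at hup
      have := ho.eq_of_vert_eq hd
      omega
    obtain ⟨n, hn⟩ := exists_pow_of_vert_eq hd
    -- The vertex carries a descending and an ascending dart, so some descending dart is followed by
    -- an ascending one. In the face between them the new edge leads to the smaller label.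
    obtain ⟨z, hz⟩ : ∃ z, ¬ Q.Ascends l z ∧ Q.vert z = Q.vert (ι x) ∧ Q.Ascends l (Q.rot z) := by
      by_contra! hne
      have : ∀ n : ℕ, ¬ Q.Ascends l ((Q.rot ^ n) d) := by
        intro n
        induction n with
        | zero => exact hdn
        | succ n ih =>
          rw [pow_succ', Equiv.Perm.mul_apply]
          exact hne _ ih (by rw [Q.vert_rot_pow, hd])
      exact this n (hn ▸ h.ascends x)
    obtain ⟨hz, hzv, hup⟩ := hz
    obtain ⟨y, rfl⟩ := h.exists_of_not_ascends hQ hz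
    rw [← Q.next_apply] at hup
    have hnext : Q.next (ι y) = ι (M.opp y) := by
      rcases h.face_cases hQ y with ⟨-, hx⟩ | ⟨-, hx, -⟩ | ⟨-, z, hx, -, -⟩
      · exact hx
      · exact absurd (hx ▸ hup) (h.not_ascends _)
      · exact absurd (hx ▸ hup) (h.not_ascends _)
    refine ⟨M.opp y, ?_, ?_⟩
    · rw [h.vert_eq_iff, ← hnext, Q.vert_next, hzv]
    · rw [M.opp_opp]
      have h₁ := h.ascends y
      rw [Ascends, ho.eq_of_vert_eq hzv] at h₁
      simp only [Function.comp]
      omega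

end IsAscentMap

end RotationSystem

/-! ### First return permutations. -/

namespace Equiv.Perm

theorem eq_of_first_pow_eq {α : Type*} {σ : Equiv.Perm α} {P : α → Prop} {a b : α} {n m : ℕ} (hn : 0 < n)
    (hnm : n ≤ m) (ha : P a) (hb : ∀ i, 0 < i → i < m → ¬ P ((σ ^ i) b))
    (hab : (σ ^ n) a = (σ ^ m) b) : a = b := by
  obtain ⟨k, rfl⟩ := Nat.exists_eq_add_of_le hnm
  rw [pow_add, Equiv.Perm.mul_apply] at hab
  have hab' := (σ ^ n).injective hab
  rcases Nat.eq_zero_or_pos k with rfl | hpos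
  · exact hab'
  · exact absurd (hab' ▸ ha) (hb k hpos (by omega))

variable {α : Type*} [Finite α]

theorem exists_first_pow_mem (σ : Equiv.Perm α) (P : α → Prop) (a : {a // P a}) :
    ∃ k : ℕ, 0 < k ∧ P ((σ ^ k) a) ∧ ∀ i, 0 < i → i < k → ¬ P ((σ ^ i) a) := by
  classical
  have hex : ∃ k : ℕ, 0 < k ∧ P ((σ ^ k) a) :=
    ⟨orderOf σ, orderOf_pos σ, by rw [pow_orderOf_eq_one]; exact a.2⟩
  exact ⟨Nat.find hex, (Nat.find_spec hex).1, (Nat.find_spec hex).2,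
    fun i h₀ h hP => Nat.find_min hex h ⟨h₀, hP⟩⟩

/-- The permutation of a subset which sends `a` to the first element of the subset after `a` in its
cycle. -/
noncomputable def firstReturn (σ : Equiv.Perm α) (P : α → Prop) : Equiv.Perm {a // P a} :=
  Equiv.ofBijective
    (fun a => ⟨(σ ^ (σ.exists_first_pow_mem P a).choose) a,
      (σ.exists_first_pow_mem P a).choose_spec.2.1⟩)
    (Finite.injective_iff_bijective.1 (by
      intro a b hab
      have hab := congrArg Subtype.val hab
      obtain ⟨ha, -, ha'⟩ := (σ.exists_first_pow_mem P a).choose_spec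
      obtain ⟨hb, -, hb'⟩ := (σ.exists_first_pow_mem P b).choose_spec
      rcases le_total (σ.exists_first_pow_mem P a).choose (σ.exists_first_pow_mem P b).choose
        with h | h
      · exact Subtype.ext (eq_of_first_pow_eq ha h a.2 hb' hab)
      · exact Subtype.ext (eq_of_first_pow_eq hb h b.2 ha' hab.symm).symm))

theorem exists_firstReturn (σ : Equiv.Perm α) (P : α → Prop) (a : {a // P a}) :
    ∃ k : ℕ, 0 < k ∧ (σ ^ k) (a : α) = σ.firstReturn P a ∧ ∀ i, 0 < i → i < k → ¬ P ((σ ^ i) a) :=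
  have h := (σ.exists_first_pow_mem P a).choose_spec
  ⟨_, h.1, rfl, h.2.2⟩

end Equiv.Perm

/-! ### The image map, and the quadrangulation built from a labelled map. -/

namespace RotationSystem

/-- The rotation system formed by joining the two ascending darts of each face. -/
noncomputable def ascentSystem {Q : RotationSystem} {l : Q.Dart → ℕ} (hQ : Q.IsQuadLabelling l) :
    RotationSystem where
  Dart := {d // Q.Ascends l d}
  finite_dart := inferInstance
  rot := Q.rot.firstReturn _
  opp := Function.Involutive.toPerm (fun d => ⟨Q.partner l d, hQ.ascends_partner d.2⟩)
    fun d => Subtype.ext (hQ.partner_partner d.2)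
  opp_opp d := Subtype.ext (hQ.partner_partner d.2)
  opp_ne d h := hQ.partner_ne d (congrArg Subtype.val h)

theorem isAscentMap_ascentSystem {Q : RotationSystem} {l : Q.Dart → ℕ} (hQ : Q.IsQuadLabelling l) :
    IsAscentMap Q (ascentSystem hQ) l Subtype.val where
  injective := Subtype.val_injective
  range c := ⟨fun ⟨x, hx⟩ => hx ▸ x.2, fun hc => ⟨⟨c, hc⟩, rfl⟩⟩
  opp _ := rfl
  rot x := Q.rot.exists_firstReturn _ x

section FirstAbove

variable {M : RotationSystem} {o : M.Vertex} {l : M.Dart → ℕ}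

open IsAscentMap

/-- `y` is the first dart with label larger than that of `x` along the left face of `x`. -/
def FirstAbove (l : M.Dart → ℕ) (x y : M.Dart) : Prop := Reaches M l (l x) x y ∧ l y = l x + 1

theorem FirstAbove.eq {x y z : M.Dart} (hy : FirstAbove l x y) (hz : FirstAbove l x z) :
    y = z := by
  obtain ⟨⟨n, rfl, hn⟩, hln⟩ := hy
  obtain ⟨⟨m, rfl, hm⟩, hlm⟩ := hz
  rcases lt_trichotomy n m with hlt | rfl | hlt
  · have := hm n hlt
    omega
  · rfl
  · have := hn m hlt
    omega

/-- Of two different starts, one lies on the run of the other together with its predecessor, whose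
label is too large for that run. -/
theorem FirstAbove.left_eq {x y z : M.Dart} (hx : FirstAbove l x z) (hy : FirstAbove l y z)
    (hx' : l x < l (M.nextLeft.symm x)) (hy' : l y < l (M.nextLeft.symm y)) : x = y := by
  have key : ∀ {x y : M.Dart} {n m : ℕ}, n ≤ m → (M.nextLeft ^ n) x = z → (M.nextLeft ^ m) y = z →
      (∀ i < m, l ((M.nextLeft ^ i) y) ≤ l y) → l z = l x + 1 → l z = l y + 1 →
      l x < l (M.nextLeft.symm x) → x = y := by
    intro x y n m hnm hn hm hi hlx hly hx'
    obtain ⟨k, rfl⟩ := Nat.exists_eq_add_of_le hnm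
    rw [pow_add, Equiv.Perm.mul_apply, ← hn] at hm
    have hxy := (M.nextLeft ^ n).injective hm
    rcases k with _ | k
    · exact hxy.symm
    · rw [pow_succ', Equiv.Perm.mul_apply] at hxy
      rw [← hxy, Equiv.symm_apply_apply] at hx'
      have := hi k (by omega)
      rw [← hxy] at hlx
      omega
  obtain ⟨⟨n, hn, hni⟩, hln⟩ := hx
  obtain ⟨⟨m, hm, hmi⟩, hlm⟩ := hy
  rcases le_total n m with hle | hle
  · exact key hle hn hm hmi hln hlm hx'
  · exact (key hle hm hn hni hlm hln hy').symm

theorem IsDistanceLabel.nextLeft_eq (h : M.IsDistanceLabel o l) (x : M.Dart) :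
    l (M.nextLeft x) = l (M.opp x) := by
  rw [← h.rot_eq, rot_nextLeft]

theorem IsDistanceLabel.opp_le' (h : M.IsDistanceLabel o l) (x : M.Dart) :
    l x ≤ l (M.opp x) + 1 := by
  simpa [M.opp_opp] using h.opp_le (M.opp x)

theorem exists_firstAbove (h : M.IsDistanceLabel o l) {x : M.Dart} (hx : l x < l (M.opp x)) :
    ∃ y, FirstAbove l (M.nextLeft (M.opp x)) y := by
  classical
  have hlx := h.opp_le x
  set a := M.nextLeft (M.opp x) with ha
  have hla : l a = l x := by rw [ha, h.nextLeft_eq, M.opp_opp]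
  have hex : ∃ n : ℕ, l ((M.nextLeft ^ n) a) = l a + 1 := by
    -- The left face contains `M.opp x`, whose label is `l a + 1`; labels rise by at most one per
    -- step, so this value is the first one above `l a`.
    have hcyc : M.nextLeft.SameCycle a (M.opp x) :=
      Equiv.Perm.sameCycle_apply_left.2 (Equiv.Perm.SameCycle.refl _ _)
    obtain ⟨n, -, hn⟩ := hcyc.exists_pow_eq'
    exact ⟨n, by rw [hn]; omega⟩
  refine ⟨_, ⟨Nat.find hex, rfl, fun i hi => ?_⟩, Nat.find_spec hex⟩
  induction i with
  | zero => exact le_rfl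
  | succ i ih =>
    have h₁ := ih (by omega)
    have h₂ := Nat.find_min hex hi
    rw [pow_succ', Equiv.Perm.mul_apply, h.nextLeft_eq] at h₂ ⊢
    have h₃ := h.opp_le ((M.nextLeft ^ i) a)
    omega

open Classical in
/-- The dart to which the descending side of index `x` is attached. -/
noncomputable def slot (l : M.Dart → ℕ) (x : M.Dart) : M.Dart :=
  if h : l x < l (M.opp x) ∧ ∃ y, FirstAbove l (M.nextLeft (M.opp x)) y then h.2.choose
  else M.nextLeft x

theorem slot_of_le {x : M.Dart} (hx : l (M.opp x) ≤ l x) : slot l x = M.nextLeft x :=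
  dif_neg fun h => hx.not_gt h.1

theorem firstAbove_slot (h : M.IsDistanceLabel o l) {x : M.Dart} (hx : l x < l (M.opp x)) :
    FirstAbove l (M.nextLeft (M.opp x)) (slot l x) := by
  have hex := exists_firstAbove h hx
  rw [slot, dif_pos ⟨hx, hex⟩]
  exact Exists.choose_spec _

theorem slot_eq (h : M.IsDistanceLabel o l) {x y : M.Dart} (hx : l x < l (M.opp x))
    (hy : FirstAbove l (M.nextLeft (M.opp x)) y) : slot l x = y :=
  (firstAbove_slot h hx).eq hy

/-- A first larger label is entered by a rise, whereas the step from `y` to `M.nextLeft y` does not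
rise. -/
theorem slot_ne_nextLeft (h : M.IsDistanceLabel o l) {x y : M.Dart} (hx : l x < l (M.opp x))
    (hy : l (M.opp y) ≤ l y) : slot l x ≠ M.nextLeft y := by
  intro hxy
  obtain ⟨⟨n, hn, hi⟩, hl⟩ := firstAbove_slot h hx
  rw [hxy, h.nextLeft_eq] at hl
  rw [hxy] at hn
  rcases n with _ | n
  · have := congrArg l (show M.nextLeft (M.opp x) = M.nextLeft y from hn)
    rw [h.nextLeft_eq y] at this
    omega
  · rw [pow_succ', Equiv.Perm.mul_apply] at hn
    have := hi n n.lt_succ_self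
    rw [M.nextLeft.injective hn] at this
    omega

theorem slot_injective (h : M.IsDistanceLabel o l) : Function.Injective (slot (M := M) l) := by
  intro x y hxy
  rcases lt_or_ge (l x) (l (M.opp x)) with hx | hx <;>
    rcases lt_or_ge (l y) (l (M.opp y)) with hy | hy
  · have hx' := firstAbove_slot h hx
    have hy' := firstAbove_slot h hy
    rw [← hxy] at hy'
    refine M.opp_injective (M.nextLeft.injective (hx'.left_eq hy' ?_ ?_)) <;>
    · rwa [Equiv.symm_apply_apply, h.nextLeft_eq, M.opp_opp]
  · rw [slot_of_le hy] at hxy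
    exact absurd hxy (slot_ne_nextLeft h hx hy)
  · rw [slot_of_le hx] at hxy
    exact absurd hxy.symm (slot_ne_nextLeft h hy hx)
  · rw [slot_of_le hx, slot_of_le hy] at hxy
    exact M.nextLeft.injective hxy

/-- Every ascending side receives exactly one descending side, so the gluing is an involution. -/
noncomputable def slotEquiv (h : M.IsDistanceLabel o l) : Equiv.Perm M.Dart :=
  Equiv.ofBijective (slot l) (Finite.injective_iff_bijective.1 (slot_injective h))

theorem slot_slotEquiv_symm (h : M.IsDistanceLabel o l) (x : M.Dart) :
    slot l ((slotEquiv h).symm x) = x := (slotEquiv h).apply_symm_apply x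

/-- The next side of a face of the quadrangulation built from `M`, whose ascending sides are the
`(x, true)` and whose descending sides are the `(x, false)`. -/
def faceNext (l : M.Dart → ℕ) : M.Dart × Bool → M.Dart × Bool
  | (x, true) => if l (M.opp x) = l x then (x, false)
      else if l x < l (M.opp x) then (M.opp x, true) else (M.opp x, false)
  | (x, false) => if l x < l (M.opp x) then (M.opp x, false) else (M.opp x, true)

/-- With `x' = M.opp x`, the cycle is up `x`, up `x'`, down `x`, down `x'` if the label rises along
`x`, and up `x`, down `x`, up `x'`, down `x'` if it is constant. -/
theorem faceNext_four (d : M.Dart × Bool) :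
    faceNext l (faceNext l (faceNext l (faceNext l d))) = d := by
  obtain ⟨x, b⟩ := d
  rcases lt_trichotomy (l (M.opp x)) (l x) with hx | hx | hx <;> cases b
  · simp [faceNext, M.opp_opp, hx, hx.not_gt, hx.ne, hx.ne']
  · simp [faceNext, M.opp_opp, hx, hx.not_gt, hx.ne, hx.ne']
  · simp [faceNext, M.opp_opp, hx]
  · simp [faceNext, M.opp_opp, hx]
  · simp [faceNext, M.opp_opp, hx, hx.not_gt, hx.ne, hx.ne']
  · simp [faceNext, M.opp_opp, hx, hx.not_gt, hx.ne, hx.ne']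

theorem faceNext_two_ne (d : M.Dart × Bool) : faceNext l (faceNext l d) ≠ d := by
  obtain ⟨x, b⟩ := d
  rcases lt_trichotomy (l (M.opp x)) (l x) with hx | hx | hx <;> cases b
  · simp [faceNext, M.opp_opp, hx, hx.not_gt, hx.ne']
  · simp [faceNext, M.opp_opp, hx, hx.not_gt, hx.ne]
  · simp [faceNext, M.opp_opp, hx, M.opp_ne]
  · simp [faceNext, hx, M.opp_ne]
  · simp [faceNext, M.opp_opp, hx, hx.not_gt]
  · simp [faceNext, M.opp_opp, hx, hx.not_gt, hx.ne, hx.ne']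

/-- The other half of an edge of the quadrangulation built from `M`. -/
noncomputable def sideOpp (h : M.IsDistanceLabel o l) (d : M.Dart × Bool) : M.Dart × Bool :=
  bif d.2 then ((slotEquiv h).symm d.1, false) else (slotEquiv h d.1, true)

theorem sideOpp_involutive (h : M.IsDistanceLabel o l) : Function.Involutive (sideOpp h) := by
  rintro ⟨x, _ | _⟩ <;> simp [sideOpp]

/-- The quadrangulation built from a map with its distance labeling. -/
noncomputable def quadSystem (h : M.IsDistanceLabel o l) : RotationSystem where
  Dart := M.Dart × Bool
  finite_dart := inferInstance
  rot := (sideOpp_involutive h).toPerm.trans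
    { toFun := faceNext l
      invFun := fun d => faceNext l (faceNext l (faceNext l d))
      left_inv := faceNext_four
      right_inv := faceNext_four }
  opp := (sideOpp_involutive h).toPerm
  opp_opp := sideOpp_involutive h
  opp_ne := by rintro ⟨x, _ | _⟩ <;> simp [sideOpp]

namespace QuadSystem

/-- The ascending dart of index `x`. -/
def up (h : M.IsDistanceLabel o l) (x : M.Dart) : (quadSystem h).Dart := (x, true)

/-- The descending dart of index `x`. -/
def down (h : M.IsDistanceLabel o l) (x : M.Dart) : (quadSystem h).Dart := (x, false)

theorem eq_up_or_eq_down (h : M.IsDistanceLabel o l) (d : (quadSystem h).Dart) :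
    (∃ x, d = up h x) ∨ ∃ x, d = down h x :=
  match d with
  | (x, true) => Or.inl ⟨x, rfl⟩
  | (x, false) => Or.inr ⟨x, rfl⟩

theorem up_injective (h : M.IsDistanceLabel o l) : Function.Injective (up h) :=
  fun _ _ hxy => congrArg Prod.fst hxy

theorem opp_up (h : M.IsDistanceLabel o l) (x : M.Dart) :
    (quadSystem h).opp (up h x) = down h ((slotEquiv h).symm x) := rfl

theorem opp_down (h : M.IsDistanceLabel o l) (x : M.Dart) :
    (quadSystem h).opp (down h x) = up h (slot l x) := rfl

theorem next_eq (h : M.IsDistanceLabel o l) (d : (quadSystem h).Dart) :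
    (quadSystem h).next d = faceNext l d :=
  congrArg (faceNext l) ((quadSystem h).opp_opp d)

theorem next_four (h : M.IsDistanceLabel o l) (d : (quadSystem h).Dart) :
    (quadSystem h).next ((quadSystem h).next ((quadSystem h).next ((quadSystem h).next d))) = d := by
  rw [next_eq, next_eq, next_eq, next_eq]
  exact faceNext_four d

theorem next_two_ne (h : M.IsDistanceLabel o l) (d : (quadSystem h).Dart) :
    (quadSystem h).next ((quadSystem h).next d) ≠ d := by
  rw [next_eq, next_eq]
  exact faceNext_two_ne d

theorem next_up_of_eq (h : M.IsDistanceLabel o l) {x : M.Dart} (hx : l x = l (M.opp x)) :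
    (quadSystem h).next (up h x) = down h x :=
  (next_eq h _).trans (if_pos hx.symm)

theorem next_up_of_lt (h : M.IsDistanceLabel o l) {x : M.Dart} (hx : l x < l (M.opp x)) :
    (quadSystem h).next (up h x) = up h (M.opp x) :=
  (next_eq h _).trans ((if_neg hx.ne').trans (if_pos hx))

theorem next_up_of_gt (h : M.IsDistanceLabel o l) {x : M.Dart} (hx : l (M.opp x) < l x) :
    (quadSystem h).next (up h x) = down h (M.opp x) :=
  (next_eq h _).trans ((if_neg hx.ne).trans (if_neg hx.le.not_gt))

theorem next_down_of_lt (h : M.IsDistanceLabel o l) {x : M.Dart} (hx : l x < l (M.opp x)) :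
    (quadSystem h).next (down h x) = down h (M.opp x) :=
  (next_eq h _).trans (if_pos hx)

theorem next_down_of_le (h : M.IsDistanceLabel o l) {x : M.Dart} (hx : l (M.opp x) ≤ l x) :
    (quadSystem h).next (down h x) = up h (M.opp x) :=
  (next_eq h _).trans (if_neg hx.not_gt)

theorem rot_up_slot (h : M.IsDistanceLabel o l) (x : M.Dart) :
    (quadSystem h).rot (up h (slot l x)) = (quadSystem h).next (down h x) := rfl

theorem rot_down (h : M.IsDistanceLabel o l) (x : M.Dart) :
    (quadSystem h).rot (down h x) = (quadSystem h).next (up h (slot l x)) := by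
  rw [← opp_down, next_opp]

/-- A descending dart starts where the ascending dart glued to it ends, hence the `+ 1`. -/
noncomputable def label (h : M.IsDistanceLabel o l) (d : (quadSystem h).Dart) : ℕ :=
  bif d.2 then l d.1 else l (slot l d.1) + 1

theorem label_up (h : M.IsDistanceLabel o l) (x : M.Dart) : label h (up h x) = l x := rfl

theorem label_down (h : M.IsDistanceLabel o l) (x : M.Dart) :
    label h (down h x) = l (slot l x) + 1 := rfl

theorem ascends_up (h : M.IsDistanceLabel o l) (x : M.Dart) :
    (quadSystem h).Ascends (label h) (up h x) := by
  unfold Ascends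
  rw [opp_up, label_down, label_up, slot_slotEquiv_symm]

theorem not_ascends_down (h : M.IsDistanceLabel o l) (x : M.Dart) :
    ¬ (quadSystem h).Ascends (label h) (down h x) := by
  unfold Ascends
  rw [opp_down, label_down, label_up]
  omega

theorem label_next (h : M.IsDistanceLabel o l) (d : (quadSystem h).Dart) :
    label h ((quadSystem h).next d) = label h ((quadSystem h).opp d) := by
  have hslot : ∀ {x : M.Dart}, l x < l (M.opp x) → l (slot l x) = l x + 1 := fun {x} hx => by
    rw [(firstAbove_slot h hx).2, h.nextLeft_eq, M.opp_opp]
  rcases eq_up_or_eq_down h d with ⟨x, rfl⟩ | ⟨x, rfl⟩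
  · rw [opp_up, label_down, slot_slotEquiv_symm]
    rcases lt_trichotomy (l x) (l (M.opp x)) with hx | hx | hx
    · rw [next_up_of_lt h hx, label_up]
      have := h.opp_le x
      omega
    · rw [next_up_of_eq h hx, label_down, slot_of_le hx.ge, h.nextLeft_eq, hx]
    · rw [next_up_of_gt h hx, label_down, hslot (by rwa [M.opp_opp])]
      have := h.opp_le' x
      omega
  · rw [opp_down, label_up]
    rcases lt_or_ge (l x) (l (M.opp x)) with hx | hx
    · rw [next_down_of_lt h hx, label_down, slot_of_le (by rw [M.opp_opp]; exact hx.le),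
        h.nextLeft_eq, M.opp_opp, hslot hx]
    · rw [next_down_of_le h hx, label_up, slot_of_le hx, h.nextLeft_eq]

theorem isQuadLabelling (h : M.IsDistanceLabel o l) :
    (quadSystem h).IsQuadLabelling (label h) where
  rot_eq d := by rw [← next_opp, label_next, opp_opp]
  opp_eq d := by
    rcases eq_up_or_eq_down h d with ⟨x, rfl⟩ | ⟨x, rfl⟩
    · exact Or.inl (ascends_up h x)
    · exact Or.inr rfl
  next_four := next_four h
  next_two_ne := next_two_ne h

/-- Converse of `Attached.reaches` for the constructed system: the run along the left face is
replayed as a rotation through descending darts. A rise of the label ends it, a constant step or a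
descent costs one turn. -/
theorem exists_rot_pow_next_up (h : M.IsDistanceLabel o l) {z y : M.Dart}
    (hzy : FirstAbove l z y) : ∃ k : ℕ,
      ((quadSystem h).rot ^ k) ((quadSystem h).next (up h z)) = up h (M.rot y) ∧
      ∀ i < k, ¬ (quadSystem h).Ascends (label h)
        (((quadSystem h).rot ^ i) ((quadSystem h).next (up h z))) := by
  obtain ⟨⟨n, hn, hi⟩, hl⟩ := hzy
  induction n using Nat.strong_induction_on generalizing z with
  | _ n ih =>
    rcases n with _ | n
    · rw [show z = y from hn] at hl
      omega
    have hstep : ∀ {b : M.Dart}, (quadSystem h).next (up h z) = down h b →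
        (∃ k : ℕ, ((quadSystem h).rot ^ k) ((quadSystem h).next (up h (slot l b)))
            = up h (M.rot y) ∧ ∀ i < k, ¬ (quadSystem h).Ascends (label h)
              (((quadSystem h).rot ^ i) ((quadSystem h).next (up h (slot l b))))) →
        ∃ k : ℕ, ((quadSystem h).rot ^ k) ((quadSystem h).next (up h z)) = up h (M.rot y) ∧
          ∀ i < k, ¬ (quadSystem h).Ascends (label h)
            (((quadSystem h).rot ^ i) ((quadSystem h).next (up h z))) := by
      rintro b hb ⟨k, hk, hki⟩
      refine ⟨k + 1, ?_, fun i hik => ?_⟩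
      · rw [hb, pow_succ, Equiv.Perm.mul_apply, rot_down, hk]
      · rw [hb]
        cases i with
        | zero => exact not_ascends_down h b
        | succ i =>
          rw [pow_succ, Equiv.Perm.mul_apply, rot_down]
          exact hki i (Nat.lt_of_succ_lt_succ hik)
    rw [pow_succ, Equiv.Perm.mul_apply] at hn
    have hi' : ∀ i < n, l ((M.nextLeft ^ i) (M.nextLeft z)) ≤ l z := fun i hin => by
      rw [← Equiv.Perm.mul_apply, ← pow_succ]
      exact hi _ (Nat.succ_lt_succ hin)
    rcases lt_trichotomy (l z) (l (M.opp z)) with hz | hz | hz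
    · refine ⟨0, ?_, fun i hi => absurd hi (Nat.not_lt_zero _)⟩
      rw [next_up_of_lt h hz]
      rcases n with _ | n
      · rw [← show M.nextLeft z = y from hn, rot_nextLeft]
        rfl
      · have := hi' 0 n.succ_pos
        rw [pow_zero, Equiv.Perm.one_apply, h.nextLeft_eq] at this
        omega
    · have hlz : l (M.nextLeft z) = l z := by rw [h.nextLeft_eq, hz]
      refine hstep (next_up_of_eq h hz) ?_
      rw [slot_of_le hz.ge]
      exact ih n n.lt_succ_self (by rwa [hlz]) hn (by rwa [hlz])
    · have hlz : l (M.nextLeft z) + 1 = l z := by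
        rw [h.nextLeft_eq]
        have := h.opp_le' z
        omega
      have hfirst := firstAbove_slot h (x := M.opp z) (by rwa [M.opp_opp])
      rw [M.opp_opp] at hfirst
      refine hstep (next_up_of_gt h hz) ?_
      obtain ⟨⟨p, hp, hpi⟩, hlp⟩ := hfirst
      -- The run has to climb back to `l z` before it can attain `l z + 1` at `y`.
      have hpn : p ≤ n := by
        by_contra hlt
        have := hpi n (lt_of_not_ge hlt)
        rw [hn] at this
        omega
      obtain ⟨q, rfl⟩ := Nat.exists_eq_add_of_le' hpn
      have hp₀ : p ≠ 0 := by
        rintro rfl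
        rw [← show M.nextLeft z = slot l (M.opp z) from hp] at hlp
        omega
      refine ih q (by omega) (by omega) ?_ fun i hiq => ?_
      · rw [← hp, ← hn, pow_add, Equiv.Perm.mul_apply]
      · have := hi' (i + p) (by omega)
        rw [pow_add, Equiv.Perm.mul_apply, hp] at this
        omega

theorem isAscentMap (h : M.IsDistanceLabel o l) :
    IsAscentMap (quadSystem h) M (label h) (up h) where
  injective := up_injective h
  range d := by
    constructor
    · rintro ⟨x, rfl⟩
      exact ascends_up h x
    · intro hd
      rcases eq_up_or_eq_down h d with ⟨x, rfl⟩ | ⟨x, rfl⟩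
      · exact ⟨x, rfl⟩
      · exact absurd hd (not_ascends_down h x)
  opp x := by
    unfold partner
    rcases lt_trichotomy (l x) (l (M.opp x)) with hx | hx | hx
    · rw [next_up_of_lt h hx, if_pos (ascends_up h _)]
    · rw [next_up_of_eq h hx, if_neg (not_ascends_down h _), next_down_of_le h hx.ge,
        if_pos (ascends_up h _)]
    · rw [next_up_of_gt h hx, if_neg (not_ascends_down h _),
        next_down_of_lt h (by rwa [M.opp_opp]), if_neg (not_ascends_down h _), M.opp_opp,
        next_down_of_le h hx.le]
  rot x := by
    -- The dart following `up x` in the rotation is read off from the descending side glued to it.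
    obtain ⟨y, rfl⟩ : ∃ y, slot l y = x := (slotEquiv h).surjective x
    rcases lt_or_ge (l y) (l (M.opp y)) with hy | hy
    · have hy' : l (M.opp (M.opp y)) ≤ l (M.opp y) := by rw [M.opp_opp]; exact hy.le
      obtain ⟨k, hk, hki⟩ := exists_rot_pow_next_up h (firstAbove_slot h hy)
      have hrot := rot_up_slot h y
      rw [next_down_of_lt h hy] at hrot
      have hrot₂ := rot_down h (M.opp y)
      rw [slot_of_le hy'] at hrot₂
      refine ⟨k + 2, by omega, ?_, fun i hi₀ hi => ?_⟩
      · rw [pow_add, Equiv.Perm.mul_apply, pow_two, Equiv.Perm.mul_apply, hrot, hrot₂, hk]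
      · obtain ⟨i, rfl⟩ := Nat.exists_eq_succ_of_ne_zero hi₀.ne'
        rw [Nat.succ_eq_add_one, pow_succ, Equiv.Perm.mul_apply, hrot]
        cases i with
        | zero => exact not_ascends_down h _
        | succ i =>
          rw [pow_succ, Equiv.Perm.mul_apply, hrot₂]
          exact hki i (by omega)
    · refine ⟨1, one_pos, ?_, fun i hi₀ hi => by omega⟩
      rw [pow_one, rot_up_slot, next_down_of_le h hy, slot_of_le hy, rot_nextLeft]

theorem isDistanceLabel (h : M.IsDistanceLabel o l) {x₀ : M.Dart} (hx₀ : M.vert x₀ = o) :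
    (quadSystem h).IsDistanceLabel ((quadSystem h).vert (up h x₀)) (label h) where
  rot_eq := (isQuadLabelling h).rot_eq
  opp_le d := by
    have := (isQuadLabelling h).opp_eq d
    omega
  zero_iff d := by
    constructor
    · intro hd
      rcases eq_up_or_eq_down h d with ⟨x, rfl⟩ | ⟨x, rfl⟩
      · exact (isAscentMap h).vert_eq_iff.1 (((h.zero_iff x).1 hd).trans hx₀.symm)
      · exact absurd hd (Nat.succ_ne_zero _)
    · intro hd
      rw [((quadSystem h).vert_eq_iff.1 hd).apply_eq_of_invariant
        (isQuadLabelling h).rot_eq, label_up, h.zero_iff, hx₀]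
  exists_lt d hd := by
    rcases eq_up_or_eq_down h d with ⟨x, rfl⟩ | ⟨x, rfl⟩
    · obtain ⟨y, hy, hlt⟩ := h.exists_lt x hd
      -- The label rises along `M.opp y`, so its face has a side from the smaller label to the
      -- vertex of `up y`.
      refine ⟨(quadSystem h).opp (up h (M.opp y)), ?_, ?_⟩
      · rw [← vert_next, next_up_of_lt, M.opp_opp]
        · exact (isAscentMap h).vert_eq_iff.1 hy
        · rw [M.opp_opp, h.eq_of_vert_eq hy]
          exact hlt
      · rw [opp_opp]
        exact hlt
    · exact ⟨down h x, rfl, Nat.lt_succ_self _⟩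

end QuadSystem

end FirstAbove

/-! ### A quadrangulation is determined by its image map. -/

section Uniqueness

open QuadSystem

variable {Q M : RotationSystem} {l : Q.Dart → ℕ} {ι : M.Dart → Q.Dart} {o : M.Vertex}

/-- The isomorphism from the quadrangulation built from `M` to any quadrangulation which gives
`M`. -/
noncomputable def fromQuadSystem (hM : M.IsDistanceLabel o (l ∘ ι))
    (d : (quadSystem hM).Dart) : Q.Dart :=
  bif d.2 then ι d.1 else Q.opp (ι (slot (l ∘ ι) d.1))

theorem fromQuadSystem_up (hM : M.IsDistanceLabel o (l ∘ ι)) (x : M.Dart) :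
    fromQuadSystem hM (up hM x) = ι x := rfl

theorem fromQuadSystem_down (hM : M.IsDistanceLabel o (l ∘ ι)) (x : M.Dart) :
    fromQuadSystem hM (down hM x) = Q.opp (ι (slot (l ∘ ι) x)) := rfl

theorem fromQuadSystem_opp (hM : M.IsDistanceLabel o (l ∘ ι)) (d : (quadSystem hM).Dart) :
    fromQuadSystem hM ((quadSystem hM).opp d) = Q.opp (fromQuadSystem hM d) := by
  rcases eq_up_or_eq_down hM d with ⟨x, rfl⟩ | ⟨x, rfl⟩
  · rw [opp_up, fromQuadSystem_down, fromQuadSystem_up, slot_slotEquiv_symm]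
  · rw [opp_down, fromQuadSystem_down, fromQuadSystem_up, Q.opp_opp]

theorem fromQuadSystem_next (hQ : Q.IsQuadLabelling l) (h : IsAscentMap Q M l ι)
    (hM : M.IsDistanceLabel o (l ∘ ι)) (d : (quadSystem hM).Dart) :
    fromQuadSystem hM ((quadSystem hM).next d) = Q.next (fromQuadSystem hM d) := by
  -- Here `Attached.reaches` enters: the gluing observed in `Q` is the one computed by `slot`.
  have hlower : ∀ {x x' : M.Dart}, l (ι (M.opp x)) < l (ι x) →
      Q.rot (ι x') = Q.opp (ι (M.nextLeft x)) → slot (l ∘ ι) (M.opp x) = x' := by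
    intro x x' hx hx'
    have hatt := IsAscentMap.Attached.of_rot_eq h hx'
    refine slot_eq hM (by simpa [M.opp_opp] using hx) ?_
    rw [M.opp_opp]
    exact ⟨hatt.reaches hQ h, hatt.label hQ h⟩
  rcases eq_up_or_eq_down hM d with ⟨x, rfl⟩ | ⟨x, rfl⟩
  · rw [fromQuadSystem_up]
    rcases h.face_cases hQ x with ⟨hl, hn⟩ | ⟨hl, hn, -⟩ | ⟨hl, x', hn, hx', -⟩
    · have hlt : l (ι x) < l (ι (M.opp x)) := by omega
      rw [next_up_of_lt hM hlt, hn, fromQuadSystem_up]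
    · rw [next_up_of_eq hM hl.symm, hn, fromQuadSystem_down, slot_of_le (l := l ∘ ι) hl.le]
    · have hlt : l (ι (M.opp x)) < l (ι x) := by omega
      rw [next_up_of_gt hM hlt, hn, fromQuadSystem_down, hlower hlt hx']
  · rw [fromQuadSystem_down, Q.next_opp]
    rcases lt_or_ge (l (ι x)) (l (ι (M.opp x))) with hx | hx
    · rw [next_down_of_lt hM hx]
      rcases h.face_cases hQ (M.opp x) with ⟨hl, -⟩ | ⟨hl, -⟩ | ⟨hl, x', -, hx', -⟩
      · rw [M.opp_opp] at hl
        omega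
      · rw [M.opp_opp] at hl
        omega
      · have := hlower (x := M.opp x) (by rwa [M.opp_opp]) hx'
        rw [M.opp_opp] at this
        rw [this, hx', fromQuadSystem_down, slot_of_le]
        simp only [Function.comp, M.opp_opp]
        exact hx.le
    · rw [next_down_of_le hM hx, slot_of_le (l := l ∘ ι) hx, fromQuadSystem_up]
      rcases h.face_cases hQ x with ⟨hl, -⟩ | ⟨-, -, hr⟩ | ⟨-, x', -, -, hr⟩
      · omega
      · exact hr.symm
      · exact hr.symm

theorem fromQuadSystem_rot (hQ : Q.IsQuadLabelling l) (h : IsAscentMap Q M l ι)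
    (hM : M.IsDistanceLabel o (l ∘ ι)) (d : (quadSystem hM).Dart) :
    fromQuadSystem hM ((quadSystem hM).rot d) = Q.rot (fromQuadSystem hM d) := by
  rw [← next_opp, fromQuadSystem_next hQ h, fromQuadSystem_opp, Q.next_opp]

theorem fromQuadSystem_bijective (hQ : Q.IsQuadLabelling l) (h : IsAscentMap Q M l ι)
    (hM : M.IsDistanceLabel o (l ∘ ι)) : Function.Bijective (fromQuadSystem hM) := by
  constructor
  · intro c d hcd
    rcases eq_up_or_eq_down hM c with ⟨x, rfl⟩ | ⟨x, rfl⟩ <;>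
      rcases eq_up_or_eq_down hM d with ⟨y, rfl⟩ | ⟨y, rfl⟩ <;>
      simp only [fromQuadSystem_up, fromQuadSystem_down] at hcd
    · rw [h.injective hcd]
    · exact absurd (hcd ▸ h.ascends x) (h.not_ascends (slot (l ∘ ι) y))
    · exact absurd (hcd ▸ h.ascends y) (h.not_ascends (slot (l ∘ ι) x))
    · rw [slot_injective hM (h.injective (Q.opp_injective hcd))]
  · intro d
    by_cases hd : Q.Ascends l d
    · obtain ⟨x, rfl⟩ := (h.range _).2 hd
      exact ⟨up hM x, rfl⟩
    · obtain ⟨x, rfl⟩ := h.exists_of_not_ascends hQ hd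
      refine ⟨down hM ((slotEquiv hM).symm x), ?_⟩
      rw [fromQuadSystem_down, slot_slotEquiv_symm]

theorem label_fromQuadSystem (h : IsAscentMap Q M l ι)
    (hM : M.IsDistanceLabel o (l ∘ ι)) (d : (quadSystem hM).Dart) :
    l (fromQuadSystem hM d) = QuadSystem.label hM d := by
  rcases eq_up_or_eq_down hM d with ⟨x, rfl⟩ | ⟨x, rfl⟩
  · rfl
  · exact h.ascends _

end Uniqueness

end RotationSystem

/-! ### Face degree four, and transport along isomorphisms. -/

namespace RotationSystem

variable (R : RotationSystem)

theorem faceDegree_face (d : R.Dart) :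
    R.faceDegree (R.face d) = Function.minimalPeriod R.next d := by
  have horbit : ({c | R.face c = R.face d} : Set R.Dart)
      = MulAction.orbit (Subgroup.zpowers R.next) d := by
    ext c
    rw [Set.mem_ofPred_eq, eq_comm, R.face_eq_iff]
    constructor
    · rintro ⟨n, hn⟩
      exact ⟨⟨R.next ^ n, n, rfl⟩, hn⟩
    · rintro ⟨⟨_, n, rfl⟩, hn⟩
      exact ⟨n, hn⟩
  have := Fintype.ofFinite (MulAction.orbit (Subgroup.zpowers R.next) d)
  have hcard := MulAction.minimalPeriod_eq_card (a := R.next) (b := d)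
  rw [← Nat.card_eq_fintype_card, ← horbit] at hcard
  exact hcard.symm

theorem faceDegree_face_eq_four_iff (d : R.Dart) : R.faceDegree (R.face d) = 4 ↔
    R.next (R.next (R.next (R.next d))) = d ∧ R.next (R.next d) ≠ d := by
  rw [faceDegree_face]
  have h₂ : R.next (R.next d) = d ↔ Function.minimalPeriod R.next d ∣ 2 :=
    Function.isPeriodicPt_iff_minimalPeriod_dvd (f := R.next) (n := 2)
  have h₄ : R.next (R.next (R.next (R.next d))) = d ↔ Function.minimalPeriod R.next d ∣ 4 :=
    Function.isPeriodicPt_iff_minimalPeriod_dvd (f := R.next) (n := 4)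
  rw [h₄, ne_eq, h₂]
  constructor
  · intro h
    rw [h]
    decide
  · rintro ⟨h, h'⟩
    have hle := Nat.le_of_dvd (by norm_num) h
    interval_cases Function.minimalPeriod R.next d <;> simp_all

end RotationSystem

namespace IsMapIso

variable {M N : RotationSystem} {f : M.Dart ≃ N.Dart}

theorem map_rot_pow (hf : IsMapIso M N f) (n : ℕ) (d : M.Dart) :
    f ((M.rot ^ n) d) = (N.rot ^ n) (f d) := by
  induction n with
  | zero => rfl
  | succ n ih => rw [pow_succ', pow_succ', Equiv.Perm.mul_apply, Equiv.Perm.mul_apply, hf.1, ih]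

theorem map_next (hf : IsMapIso M N f) (d : M.Dart) : f (M.next d) = N.next (f d) := by
  rw [M.next_apply, N.next_apply, hf.1, hf.2]

theorem vert_eq_iff (hf : IsMapIso M N f) {a b : M.Dart} :
    N.vert (f a) = N.vert (f b) ↔ M.vert a = M.vert b := by
  constructor
  · intro h
    obtain ⟨n, hn⟩ := RotationSystem.exists_pow_of_vert_eq h
    rw [← hf.map_rot_pow] at hn
    rw [← f.injective hn, M.vert_rot_pow]
  · intro h
    obtain ⟨n, rfl⟩ := RotationSystem.exists_pow_of_vert_eq h
    rw [hf.map_rot_pow, N.vert_rot_pow]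

theorem edge_eq_iff (hf : IsMapIso M N f) {a b : M.Dart} :
    N.edge (f a) = N.edge (f b) ↔ M.edge a = M.edge b := by
  rw [N.edge_eq_iff, M.edge_eq_iff, ← hf.2, f.apply_eq_iff_eq, f.apply_eq_iff_eq]

theorem isDistanceLabel (hf : IsMapIso M N f) {o : M.Vertex} {o' : N.Vertex} {l : N.Dart → ℕ}
    (ho : ∀ d, M.vert d = o ↔ N.vert (f d) = o') (h : N.IsDistanceLabel o' l) :
    M.IsDistanceLabel o (l ∘ f) where
  rot_eq d := by rw [Function.comp, Function.comp, hf.1, h.rot_eq]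
  opp_le d := by
    rw [Function.comp, Function.comp, hf.2]
    exact h.opp_le _
  zero_iff d := (h.zero_iff _).trans (ho d).symm
  exists_lt d hd := by
    obtain ⟨c, hc, hlt⟩ := h.exists_lt _ hd
    obtain ⟨b, rfl⟩ := f.surjective c
    exact ⟨b, hf.vert_eq_iff.1 hc, by rwa [Function.comp, hf.2]⟩

theorem ascends_iff (hf : IsMapIso M N f) {l : N.Dart → ℕ} (d : M.Dart) :
    M.Ascends (l ∘ f) d ↔ N.Ascends l (f d) := by
  rw [RotationSystem.Ascends, RotationSystem.Ascends, Function.comp, Function.comp, hf.2]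

theorem map_partner (hf : IsMapIso M N f) {l : N.Dart → ℕ} (d : M.Dart) :
    f (M.partner (l ∘ f) d) = N.partner l (f d) := by
  have h₁ := hf.ascends_iff (l := l) (M.next d)
  have h₂ := hf.ascends_iff (l := l) (M.next (M.next d))
  simp only [hf.map_next] at h₁ h₂
  unfold RotationSystem.partner
  by_cases h : N.Ascends l (N.next (f d))
  · rw [if_pos h, if_pos (h₁.2 h), hf.map_next]
  · rw [if_neg h, if_neg (mt h₁.1 h)]
    by_cases h' : N.Ascends l (N.next (N.next (f d)))
    · rw [if_pos h', if_pos (h₂.2 h'), hf.map_next, hf.map_next]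
    · rw [if_neg h', if_neg (mt h₂.1 h'), hf.map_next, hf.map_next, hf.map_next]

end IsMapIso

namespace RotationSystem.IsAscentMap

variable {Q Q' M M' : RotationSystem} {l : Q'.Dart → ℕ}

theorem map_left {f : Q.Dart ≃ Q'.Dart} (hf : IsMapIso Q Q' f) {ι : M.Dart → Q.Dart}
    (h : IsAscentMap Q M (l ∘ f) ι) : IsAscentMap Q' M l (f ∘ ι) where
  injective := f.injective.comp h.injective
  range c := by
    obtain ⟨d, rfl⟩ := f.surjective c
    rw [← hf.ascends_iff, ← h.range]
    simp
  opp x := by rw [Function.comp, Function.comp, h.opp, hf.map_partner]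
  rot x := by
    obtain ⟨k, hk, hk', hi⟩ := h.rot x
    refine ⟨k, hk, ?_, fun i h₀ h₁ => ?_⟩
    · rw [Function.comp, ← hf.map_rot_pow, hk']
      rfl
    · rw [Function.comp, ← hf.map_rot_pow, ← hf.ascends_iff]
      exact hi i h₀ h₁

theorem map_right {f : M'.Dart ≃ M.Dart} (hf : IsMapIso M' M f) {ι : M.Dart → Q'.Dart}
    (h : IsAscentMap Q' M l ι) : IsAscentMap Q' M' l (ι ∘ f) where
  injective := h.injective.comp f.injective
  range c := by
    rw [← h.range]
    exact (f.surjective.exists (p := fun x => ι x = c)).symm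
  opp x := by rw [Function.comp, Function.comp, hf.2, h.opp]
  rot x := by
    rw [Function.comp, Function.comp, hf.1]
    exact h.rot (f x)

end RotationSystem.IsAscentMap

/-! ### Rooted pointed objects and the bijection between their classes. -/

namespace RootedPointedQuadrangulation

open RotationSystem

variable (Q : RootedPointedQuadrangulation)

theorem isDistanceLabel_lab : Q.IsDistanceLabel Q.origin Q.lab :=
  isDistanceLabel_label Q.connected Q.origin

theorem isQuadLabelling_lab : Q.IsQuadLabelling Q.lab where
  rot_eq := Q.isDistanceLabel_lab.rot_eq
  opp_eq := by
    have := Fintype.ofFinite Q.Dart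
    obtain ⟨φ, hφ⟩ := exists_two_colouring Q.connected Q.euler fun f => by
      rw [Q.degree_four f]
      decide
    exact Q.toRotationSystem.opp_label_of_two_colouring Q.connected hφ Q.origin
  next_four d := ((Q.faceDegree_face_eq_four_iff d).1 (Q.degree_four _)).1
  next_two_ne d := ((Q.faceDegree_face_eq_four_iff d).1 (Q.degree_four _)).2

variable {Q}

theorem Draws.eq_partner {c c' : Q.Dart} (h : Q.Draws c c') :
    Q.Ascends Q.lab c ∧ c' = Q.partner Q.lab c := by
  have hQ := Q.isQuadLabelling_lab
  unfold partner
  cases h with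
  | simple h₁ h₂ h₃ =>
    refine ⟨(hQ.ascends_iff c).2 h₁, ?_⟩
    rw [if_pos]
    rw [hQ.ascends_iff, h₁, h₂]
  | confluent h₁ h₂ h₃ =>
    refine ⟨(hQ.ascends_iff c).2 h₁, ?_⟩
    rw [if_neg, if_pos]
    · rw [hQ.ascends_iff, h₂, h₃]
    · rw [hQ.ascends_iff, h₁, h₂]
      omega

theorem joined_iff {c c' : Q.Dart} :
    Q.Joined c c' ↔ Q.Ascends Q.lab c ∧ c' = Q.partner Q.lab c := by
  have hQ := Q.isQuadLabelling_lab
  constructor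
  · rintro (h | h)
    · exact h.eq_partner
    · obtain ⟨hc, rfl⟩ := h.eq_partner
      exact ⟨hQ.ascends_partner hc, (hQ.partner_partner hc).symm⟩
  · rintro ⟨hc, rfl⟩
    have h₀ := hQ.label_of_ascends hc
    have h₃ := hQ.next_cases (Q.next (Q.next (Q.next c)))
    rw [hQ.next_four] at h₃
    unfold partner
    split_ifs with h h'
    · have h₁ := hQ.label_of_ascends h
      have h₂ := hQ.next_cases (Q.next (Q.next c))
      exact Or.inl (.simple c h₀ (by omega) (by omega))
    · have h₁ := hQ.label_of_not_ascends h
      have h₂ := hQ.label_of_ascends h'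
      exact Or.inl (.confluent c h₀ (by omega) (by omega))
    -- Here `c` is the upper of the two joined corners of a simple face; the edge is drawn from the
    -- preceding corner.
    · have h₁ := hQ.label_of_not_ascends h
      have h₂ := hQ.label_of_not_ascends h'
      have := Draws.simple (Q.next (Q.next (Q.next c)))
      rw [hQ.next_four] at this
      exact Or.inr (this (by omega) (by omega) (by omega))

theorem mem_colouredCorners {c : Q.Dart} : c ∈ Q.colouredCorners ↔ Q.Ascends Q.lab c := by
  simp [colouredCorners, joined_iff]

theorem exists_ascends_of_edge (e : Q.Edge) : ∃ d, Q.Ascends Q.lab d ∧ Q.edge d = e := by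
  obtain ⟨d, rfl⟩ := Q.edge_surjective e
  by_cases hd : Q.Ascends Q.lab d
  · exact ⟨d, hd, rfl⟩
  · exact ⟨_, Q.isQuadLabelling_lab.ascends_opp hd, Q.edge_opp d⟩

theorem isColouring_iff {M : RootedPointedMap} {ι : M.Dart → Q.Dart} : Q.IsColouring M ι ↔
    IsAscentMap Q.toRotationSystem M.toRotationSystem Q.lab ι ∧
      (∀ x, M.vert x = M.origin ↔ Q.vert (ι x) = Q.origin) ∧ Q.edge (ι M.root) = Q.root := by
  constructor
  · rintro ⟨hinj, hrange, hedges, hrot, horigin, d, hd, hlt, j, hj, hij⟩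
    have hasc : Q.Ascends Q.lab d := (Q.isQuadLabelling_lab.opp_eq d).resolve_right (by omega)
    refine ⟨⟨hinj, fun c => ?_, fun x => (joined_iff.1 (hedges x)).2, fun x => ?_⟩, horigin, ?_⟩
    · rw [← mem_colouredCorners, ← hrange, Set.mem_range]
    · obtain ⟨-, k, hk, hk', hi⟩ := hrot x
      exact ⟨k, hk, hk', fun i h₀ h₁ => mem_colouredCorners.not.1 (hi i h₀ h₁)⟩
    -- The ascending dart of the root edge is itself a coloured corner, hence the first dart of its
    -- sector.
    · rcases Nat.eq_zero_or_pos j with rfl | hpos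
      · rw [← hd, ← hj]
        rfl
      · exact absurd (mem_colouredCorners.2 (hj ▸ hasc)) (hij j hpos le_rfl)
  · rintro ⟨h, horigin, hroot⟩
    refine ⟨h.injective, ?_, fun x => joined_iff.2 ⟨h.ascends x, h.opp x⟩, fun x => ?_, horigin,
      ι M.root, hroot, ?_, 0, rfl, fun i h₀ h₁ => absurd h₁ (by omega)⟩
    · ext c
      rw [Set.mem_range, h.range, mem_colouredCorners]
    · obtain ⟨k, hk, hk', hi⟩ := h.rot x
      exact ⟨mem_colouredCorners.2 (h.ascends _), k, hk, hk',
        fun i h₀ h₁ => mem_colouredCorners.not.2 (hi i h₀ h₁)⟩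
    · have := h.ascends M.root
      rw [Ascends] at this
      omega

theorem IsColouring.lab_eq {M : RootedPointedMap} {ι : M.Dart → Q.Dart} (h : Q.IsColouring M ι)
    (x : M.Dart) : M.label M.origin x = Q.lab (ι x) := by
  obtain ⟨hι, ho, -⟩ := isColouring_iff.1 h
  exact (hι.isDistanceLabel_left Q.isQuadLabelling_lab Q.isDistanceLabel_lab ho).label_eq x

variable (Q)

theorem exists_yields : ∃ M : RootedPointedMap, Q.Yields M := by
  have hQ := Q.isQuadLabelling_lab
  have hι := isAscentMap_ascentSystem hQ
  obtain ⟨a, ha⟩ := Q.vert_surjective Q.origin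
  have ha' : Q.Ascends Q.lab a := by
    have := hQ.opp_eq a
    have := (Q.isDistanceLabel_lab.zero_iff a).2 ha
    rw [Ascends]
    omega
  obtain ⟨r, hr, hroot⟩ := exists_ascends_of_edge Q.root
  have ho : ∀ x, (ascentSystem hQ).vert x = (ascentSystem hQ).vert ⟨a, ha'⟩ ↔
      Q.vert x.1 = Q.origin := fun x => by rw [← ha]; exact hι.vert_eq_iff
  let M : RootedPointedMap :=
    { toRotationSystem := ascentSystem hQ
      connected := (hι.isDistanceLabel_left hQ Q.isDistanceLabel_lab ho).connected
      euler := (hι.euler_iff hQ).2 Q.euler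
      origin := (ascentSystem hQ).vert ⟨a, ha'⟩
      root := ⟨r, hr⟩ }
  exact ⟨M, Subtype.val, isColouring_iff.2 ⟨hι, ho, hroot⟩⟩

variable {Q}

theorem exists_yields_of_map (M : RootedPointedMap) :
    ∃ Q : RootedPointedQuadrangulation, Q.Yields M := by
  have h := isDistanceLabel_label M.connected M.origin
  have hQ := QuadSystem.isQuadLabelling h
  have hι := QuadSystem.isAscentMap h
  obtain ⟨a, ha⟩ := M.vert_surjective M.origin
  have hlab := QuadSystem.isDistanceLabel h ha
  let Q : RootedPointedQuadrangulation :=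
    { toRotationSystem := quadSystem h
      connected := hlab.connected
      euler := (hι.euler_iff hQ).1 M.euler
      degree_four := fun f => by
        obtain ⟨d, rfl⟩ := (quadSystem h).face_surjective f
        exact ((quadSystem h).faceDegree_face_eq_four_iff d).2 ⟨hQ.next_four d, hQ.next_two_ne d⟩
      origin := (quadSystem h).vert (QuadSystem.up h a)
      root := (quadSystem h).edge (QuadSystem.up h M.root) }
  have hQlab : Q.lab = QuadSystem.label h := funext hlab.label_eq
  refine ⟨Q, QuadSystem.up h, isColouring_iff.2 ⟨hQlab ▸ hι, fun x => ?_, rfl⟩⟩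
  exact (Eq.congr_right ha.symm).trans hι.vert_eq_iff

/-- Both dart sets are identified with the ascending darts of `Q`, and partner, first return, origin
and root are determined there. -/
theorem Yields.iso {M N : RootedPointedMap} (hM : Q.Yields M) (hN : Q.Yields N) : M.Iso N := by
  obtain ⟨ι, hι⟩ := hM
  obtain ⟨κ, hκ⟩ := hN
  obtain ⟨hι, ho, hr⟩ := isColouring_iff.1 hι
  obtain ⟨hκ, ho', hr'⟩ := isColouring_iff.1 hκ
  have hex : ∀ x, ∃ y, κ y = ι x := fun x => (hκ.range _).2 (hι.ascends x)
  choose f hf using hex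
  have hf' : Function.Bijective f := by
    constructor
    · intro x y hxy
      apply hι.injective
      rw [← hf, ← hf, hxy]
    · intro y
      obtain ⟨x, hx⟩ := (hι.range _).2 (hκ.ascends y)
      exact ⟨x, hκ.injective (by rw [hf, hx])⟩
  refine ⟨Equiv.ofBijective f hf', ⟨fun x => ?_, fun x => ?_⟩, fun x => ?_, ?_⟩
  · apply hκ.injective
    obtain ⟨k, hk, hk', hi⟩ := hι.rot x
    obtain ⟨m, hm, hm', hj⟩ := hκ.rot (f x)
    simp only [Equiv.ofBijective_apply]
    rw [hf] at hm' hj ⊢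
    rw [← hm', ← hk']
    rcases lt_trichotomy k m with hlt | rfl | hlt
    · exact absurd (hk' ▸ hι.ascends _) (hj k hk hlt)
    · rfl
    · exact absurd (hm' ▸ hκ.ascends _) (hi m hm hlt)
  · apply hκ.injective
    simp only [Equiv.ofBijective_apply]
    rw [hf, hι.opp, hκ.opp, hf]
  · rw [ho, Equiv.ofBijective_apply, ho', hf]
  · apply hκ.injective
    rw [Equiv.ofBijective_apply, hf]
    rw [← hr', Q.edge_eq_iff] at hr
    rcases hr with hr | hr
    · exact hr.symm
    · exact absurd (hr ▸ hκ.ascends N.root) (hι.not_ascends M.root)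

/-- The labeling is a variable tied by `hl` so that it can be replaced by `Q.lab ∘ ι`; the system
`quadSystem hM` still depends on `M` only, which lets two preimages be compared through it. -/
theorem Yields.exists_quadSystem_iso {M : RootedPointedMap} {ι : M.Dart → Q.Dart}
    (h : Q.IsColouring M ι) {l : M.Dart → ℕ} (hl : l = M.label M.origin)
    (hM : M.IsDistanceLabel M.origin l) :
    ∃ f : (quadSystem hM).Dart ≃ Q.Dart, IsMapIso (quadSystem hM) Q.toRotationSystem f ∧
      (∀ d, Q.lab (f d) = QuadSystem.label hM d) ∧ ∀ x, f (QuadSystem.up hM x) = ι x := by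
  have hQ := Q.isQuadLabelling_lab
  obtain rfl : l = Q.lab ∘ ι := hl.trans (funext h.lab_eq)
  have hι := (isColouring_iff.1 h).1
  exact ⟨Equiv.ofBijective _ (fromQuadSystem_bijective hQ hι hM),
    ⟨fromQuadSystem_rot hQ hι hM, fromQuadSystem_opp hM⟩, label_fromQuadSystem hι hM, fun _ => rfl⟩

theorem Yields.iso_left {R : RootedPointedQuadrangulation} {M : RootedPointedMap}
    (hQ : Q.Yields M) (hR : R.Yields M) : Q.Iso R := by
  have hM := isDistanceLabel_label M.connected M.origin
  obtain ⟨ι, hι⟩ := hQ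
  obtain ⟨κ, hκ⟩ := hR
  obtain ⟨f, hf, hfl, hfu⟩ := Yields.exists_quadSystem_iso hι rfl hM
  obtain ⟨g, hg, hgl, hgu⟩ := Yields.exists_quadSystem_iso hκ rfl hM
  refine ⟨f.symm.trans g, hf.symm.trans hg, fun d => ?_, fun d => ?_⟩
  · obtain ⟨c, rfl⟩ := f.surjective d
    -- The origin is recognised as the zero set of the labels, which both isomorphisms preserve.
    rw [Equiv.trans_apply, Equiv.symm_apply_apply, ← Q.isDistanceLabel_lab.zero_iff,
      ← R.isDistanceLabel_lab.zero_iff, hfl, hgl]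
  · obtain ⟨c, rfl⟩ := f.surjective d
    rw [Equiv.trans_apply, Equiv.symm_apply_apply, ← (isColouring_iff.1 hι).2.2,
      ← (isColouring_iff.1 hκ).2.2, ← hfu, ← hgu, hf.edge_eq_iff, hg.edge_eq_iff]

theorem Yields.of_iso_left {R : RootedPointedQuadrangulation} {M : RootedPointedMap}
    (h : Q.Yields M) (hQR : Q.Iso R) : R.Yields M := by
  obtain ⟨f, hf, ho, hr⟩ := hQR
  obtain ⟨ι, hι⟩ := h
  obtain ⟨hι, hio, hir⟩ := isColouring_iff.1 hι
  have hlab : Q.lab = R.lab ∘ f := funext (hf.isDistanceLabel ho R.isDistanceLabel_lab).label_eq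
  rw [hlab] at hι
  exact ⟨f ∘ ι, isColouring_iff.2 ⟨hι.map_left hf, fun x => (hio x).trans (ho _), (hr _).1 hir⟩⟩

theorem Yields.of_iso_right {M N : RootedPointedMap} (h : Q.Yields M) (hMN : M.Iso N) :
    Q.Yields N := by
  obtain ⟨f, hf, ho, hr⟩ := hMN
  obtain ⟨ι, hι⟩ := h
  obtain ⟨hι, hio, hir⟩ := isColouring_iff.1 hι
  refine ⟨ι ∘ f.symm, isColouring_iff.2 ⟨hι.map_right hf.symm, fun x => ?_, ?_⟩⟩
  · rw [Function.comp, ← hio, ho, Equiv.apply_symm_apply]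
  · rw [Function.comp, ← hr, Equiv.symm_apply_apply, hir]

theorem isLocalMax_iff (v : Q.Vertex) : Q.IsLocalMax Q.origin v ↔ Q.IsPeak Q.lab v := by
  refine forall_congr' fun d => imp_congr_right fun _ => ?_
  have h := Q.isQuadLabelling_lab.opp_eq d
  rw [Ascends]
  change Q.lab (Q.opp d) ≤ Q.lab d ↔ _
  omega

theorem Yields.card_edge {M : RootedPointedMap} (h : Q.Yields M) :
    Nat.card M.Edge = Nat.card Q.Face := by
  obtain ⟨ι, hι⟩ := h
  exact (isColouring_iff.1 hι).1.card_edge Q.isQuadLabelling_lab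

theorem Yields.card_face {M : RootedPointedMap} (h : Q.Yields M) :
    Nat.card M.Face = Nat.card {v : Q.Vertex // Q.IsLocalMax Q.origin v} := by
  obtain ⟨ι, hι⟩ := h
  rw [(isColouring_iff.1 hι).1.card_face Q.isQuadLabelling_lab]
  exact Nat.card_congr (Equiv.subtypeEquivRight fun v => (isLocalMax_iff v).symm)

theorem Yields.dist_root {M : RootedPointedMap} (h : Q.Yields M) {d : Q.Dart}
    (hd : Q.edge d = Q.root) :
    M.graph.dist M.origin (M.vert M.root) = min (Q.lab d) (Q.lab (Q.opp d)) := by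
  obtain ⟨ι, hι⟩ := h
  obtain ⟨hι', -, hr⟩ := isColouring_iff.1 hι
  have hasc := hι'.ascends M.root
  rw [Ascends] at hasc
  change M.label M.origin M.root = _
  rw [hι.lab_eq]
  rw [← hr, eq_comm, Q.edge_eq_iff] at hd
  rcases hd with rfl | rfl
  · omega
  · rw [Q.opp_opp]
    omega

end RootedPointedQuadrangulation

theorem theorem2 :
    ∃ Φ : RootedPointedQuadrangulation.Class → RootedPointedMap.Class,
      (∀ (Q : RootedPointedQuadrangulation) (M : RootedPointedMap),
        Φ Q.toClass = M.toClass ↔ Q.Yields M) ∧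
      Function.Bijective Φ ∧
      ∀ (Q : RootedPointedQuadrangulation) (M : RootedPointedMap), Φ Q.toClass = M.toClass →
        Nat.card M.Edge = Nat.card Q.Face ∧
        Nat.card M.Face = Nat.card {v : Q.Vertex // Q.IsLocalMax Q.origin v} ∧
        ∀ d : Q.Dart, Q.edge d = Q.root →
          M.graph.dist M.origin (M.vert M.root) = min (Q.lab d) (Q.lab (Q.opp d)) := by
  choose F hF using RootedPointedQuadrangulation.exists_yields
  have key : ∀ (Q : RootedPointedQuadrangulation) (M : RootedPointedMap),
      (F Q).toClass = M.toClass ↔ Q.Yields M := fun Q M =>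
    ⟨fun h => (hF Q).of_iso_right (Quotient.exact h), fun h => Quotient.sound ((hF Q).iso h)⟩
  let Φ : RootedPointedQuadrangulation.Class → RootedPointedMap.Class :=
    Quotient.lift (fun Q => (F Q).toClass) fun Q R hQR =>
      ((key R _).2 ((hF Q).of_iso_left hQR)).symm
  have hΦ : ∀ (Q : RootedPointedQuadrangulation) (M : RootedPointedMap),
      Φ Q.toClass = M.toClass ↔ Q.Yields M := key
  refine ⟨Φ, hΦ, ⟨?_, ?_⟩, fun Q M h => ?_⟩
  · rintro ⟨Q⟩ ⟨R⟩ hQR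
    exact Quotient.sound ((hF Q).iso_left ((hΦ R (F Q)).1 hQR.symm))
  · rintro ⟨M⟩
    obtain ⟨Q, hQ⟩ := RootedPointedQuadrangulation.exists_yields_of_map M
    exact ⟨Q.toClass, (hΦ Q M).2 hQ⟩
  · have hQM := (hΦ Q M).1 h
    exact ⟨hQM.card_edge, hQM.card_face, fun d hd => hQM.dist_root hd⟩
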